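/- Let $\Gamma$ be a discrete subgroup of rank $r$ of the Euclidean space $(\mathbb{R}^d,+)$, $0\le r\le d$, with scalar product $\langle\cdot,\cdot\rangle$ and norm $\|\cdot\|$. Let $V_\Gamma=\mathrm{Span}_{\mathbb{R}}(\Gamma)$, let $\Gamma^*=\{y\in V_\Gamma:\ \langle y,\gamma\rangle\in\mathbb{Z}\ \text{for all}\ \gamma\in\Gamma\}$ be the dual lattice, and write $x=x_1+x_2$ with $x_1\in V_\Gamma$, $x_2\in V_\Gamma^{\perp}$. Let $\nu>0$ (if $r=d$, the value $\nu=0$ is also allowed, with the convention $(\pi/\nu)^0=1$), and let $\chi:\Gamma\to\{z\in\mathbb{C}:|z|=1\}$ be a character. Let $\Lambda(\Gamma)$ be any fundamental domain of $\Gamma$ in $\mathbb{R}^d$ and $\Lambda_1(\Gamma)$ any fundamental domain of $\Gamma$ in $V_\Gamma$, with volume $\mathrm{vol}(\Lambda_1(\Gamma))$ for the Lebesgue measure of the Euclidean space $V_\Gamma$. Let $L^{2,\nu}_{\Gamma,\chi}(\mathbb{R}^d)$ be the space of measurable functions $f:\mathbb{R}^d\to\mathbb{C}$, modulo equality almost everywhere,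 such that $$f(x+\gamma)=\chi(\gamma)\,e^{\nu\langle x+\frac{\gamma}{2},\gamma\rangle}f(x)$$ for every $\gamma\in\Gamma$ and almost every $x\in\mathbb{R}^d$, and $\int_{\Lambda(\Gamma)}|f(x)|^2e^{-\nu\|x\|^2}\,dx<\infty$, with the scalar product $\langle f,g\rangle_{\Gamma}=\int_{\Lambda(\Gamma)}f(x)\overline{g(x)}e^{-\nu\|x\|^2}\,dx$ and norm $\|f\|_{\Gamma}=\langle f,f\rangle_{\Gamma}^{1/2}$. Identify $V_\Gamma^{\perp}$ with $\mathbb{R}^{d-r}$ through an orthonormal basis, and for $\mathbf{k}\in(\mathbb{Z}_{\ge 0})^{d-r}$ let $\mathbf{H}^\nu_{\mathbf{k}}(x_2)=\mathbf{H}_{\mathbf{k}}(\sqrt{\nu}\,x_2)$, where $\mathbf{H}_{\mathbf{k}}(\xi)=(-1)^{|\mathbf{k}|}e^{\|\xi\|^2}\partial_\xi^{\mathbf{k}}e^{-\|\xi\|^2}$ is the $(d-r)$-dimensional Hermite polynomial, $|\mathbf{k}|=\sum_j k_j$ and $\mathbf{k}!=\prod_j k_j!$. Then there is a vector $v_\chi\in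 V_\Gamma$ with $\chi(\gamma)=e^{2i\pi\langle v_\chi,\gamma\rangle}$ for all $\gamma\in\Gamma$. For every such $v_\chi$, the functions $$e_{\gamma^*,\mathbf{k}}(x)=e^{\frac{\nu}{2}\langle x_1,x_1\rangle+2\pi i\langle v_\chi+\gamma^*,x_1\rangle}\,\mathbf{H}^\nu_{\mathbf{k}}(x_2),\qquad \gamma^*\in\Gamma^*,\ \mathbf{k}\in(\mathbb{Z}_{\ge 0})^{d-r},$$ belong to $L^{2,\nu}_{\Gamma,\chi}(\mathbb{R}^d)$ and form an orthogonal basis of this Hilbert space (they are nonzero and pairwise orthogonal, and their linear span is dense), with $$\|e_{\gamma^*,\mathbf{k}}\|_{\Gamma}^2=\mathrm{vol}(\Lambda_1(\Gamma))\left(\frac{\pi}{\nu}\right)^{(d-r)/2}2^{|\mathbf{k}|}\,\mathbf{k}!.$$ -/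

import Mathlib

open MeasureTheory Complex
open scoped ComplexConjugate

namespace LikewiseTheta

noncomputable section

/-- The real vector space `V_Γ` spanned by `Γ`. -/
abbrev realSpan {d : ℕ} (Γ : AddSubgroup (EuclideanSpace ℝ (Fin d))) :
    Submodule ℝ (EuclideanSpace ℝ (Fin d)) :=
  Submodule.span ℝ (Γ : Set (EuclideanSpace ℝ (Fin d)))

/-- `Γ` regarded as a subgroup of the space `V_Γ` that it spans. -/
def latticeInSpan {d : ℕ} (Γ : AddSubgroup (EuclideanSpace ℝ (Fin d))) :
    AddSubgroup (realSpan Γ) :=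
  Γ.comap (realSpan Γ).subtype.toAddMonoidHom

/-- The dual lattice `Γ* = {y ∈ V_Γ | ⟨y, γ⟩ ∈ ℤ for all γ ∈ Γ}`. -/
def dualLattice {d : ℕ} (Γ : AddSubgroup (EuclideanSpace ℝ (Fin d))) :
    AddSubgroup (EuclideanSpace ℝ (Fin d)) where
  carrier := {y | y ∈ realSpan Γ ∧ ∀ γ ∈ Γ, ∃ n : ℤ, inner ℝ y γ = (n : ℝ)}
  zero_mem' := ⟨Submodule.zero_mem _, fun γ _ => ⟨0, by simp⟩⟩
  add_mem' := by
    rintro a b ⟨ha, ha'⟩ ⟨hb, hb'⟩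
    refine ⟨Submodule.add_mem _ ha hb, fun γ hγ => ?_⟩
    obtain ⟨m, hm⟩ := ha' γ hγ
    obtain ⟨n, hn⟩ := hb' γ hγ
    exact ⟨m + n, by rw [inner_add_left, hm, hn]; push_cast; ring⟩
  neg_mem' := by
    rintro a ⟨ha, ha'⟩
    refine ⟨Submodule.neg_mem _ ha, fun γ hγ => ?_⟩
    obtain ⟨m, hm⟩ := ha' γ hγ
    exact ⟨-m, by rw [inner_neg_left, hm]; push_cast; ring⟩

/-- The factor of automorphy `χ(γ) exp(ν ⟨x + γ/2, γ⟩)`. -/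
def autFactor {d : ℕ} (ν : ℝ) (Γ : AddSubgroup (EuclideanSpace ℝ (Fin d))) (χ : Γ → Circle)
    (γ : Γ) (x : EuclideanSpace ℝ (Fin d)) : ℂ :=
  (χ γ : ℂ) * (Real.exp (ν * inner ℝ (x + (1 / 2 : ℝ) • (γ : EuclideanSpace ℝ (Fin d)))
    (γ : EuclideanSpace ℝ (Fin d))) : ℂ)

lemma autFactor_ne_zero {d : ℕ} (ν : ℝ) (Γ : AddSubgroup (EuclideanSpace ℝ (Fin d)))
    (χ : Γ → Circle) (γ : Γ) (x : EuclideanSpace ℝ (Fin d)) : autFactor ν Γ χ γ x ≠ 0 :=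
  mul_ne_zero (Circle.coe_ne_zero _) (by exact_mod_cast (Real.exp_pos _).ne')

lemma ae_shift {d : ℕ} {p : EuclideanSpace ℝ (Fin d) → Prop} (h : ∀ᵐ x, p x)
    (a : EuclideanSpace ℝ (Fin d)) : ∀ᵐ x, p (x + a) :=
  (measurePreserving_add_right volume a).quasiMeasurePreserving.ae h

lemma integrableOn_conj_mul {d : ℕ} (ν : ℝ) (Λ : Set (EuclideanSpace ℝ (Fin d)))
    (f g : EuclideanSpace ℝ (Fin d) →ₘ[volume] ℂ)
    (hf : IntegrableOn (fun x => ‖f x‖ ^ 2 * Real.exp (-ν * ‖x‖ ^ 2)) Λ)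
    (hg : IntegrableOn (fun x => ‖g x‖ ^ 2 * Real.exp (-ν * ‖x‖ ^ 2)) Λ) :
    IntegrableOn (fun x => conj (f x) * g x * (Real.exp (-ν * ‖x‖ ^ 2) : ℂ)) Λ := by
  have hc : Continuous fun x : EuclideanSpace ℝ (Fin d) =>
      ((Real.exp (-ν * ‖x‖ ^ 2) : ℝ) : ℂ) := by fun_prop
  have hm : AEStronglyMeasurable (fun x => conj (f x) * g x * (Real.exp (-ν * ‖x‖ ^ 2) : ℂ))
      (volume : Measure (EuclideanSpace ℝ (Fin d))) :=
    ((Complex.continuous_conj.comp_aestronglyMeasurable f.aestronglyMeasurable).mul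
      g.aestronglyMeasurable).mul hc.aestronglyMeasurable
  refine Integrable.mono' (hf.add hg) hm.restrict (Filter.Eventually.of_forall fun x => ?_)
  have he := Real.exp_pos (-ν * ‖x‖ ^ 2)
  simp only [norm_mul, RCLike.norm_conj, Complex.norm_real, Real.norm_eq_abs, abs_of_pos he,
    Pi.add_apply]
  nlinarith [mul_nonneg (sq_nonneg (‖f x‖ - ‖g x‖)) he.le,
    mul_nonneg (mul_nonneg (norm_nonneg (f x)) (norm_nonneg (g x))) he.le]

/-- The space of `(L², Γ, χ)`-likewise theta functions: (classes modulo null functions of) measurable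
functions `f` on `ℝ^d` with `f (x + γ) = χ(γ) exp(ν ⟨x + γ/2, γ⟩) f x` for almost every `x` and every
`γ ∈ Γ`, and with `∫_Λ |f|² exp(-ν ‖x‖²) < ∞`, where `Λ` is a fundamental domain of `Γ` in `ℝ^d`. -/
def thetaSpace {d : ℕ} (ν : ℝ) (Γ : AddSubgroup (EuclideanSpace ℝ (Fin d))) (χ : Γ → Circle)
    {Λ : Set (EuclideanSpace ℝ (Fin d))} (_hΛ : IsAddFundamentalDomain Γ Λ volume) :
    Submodule ℂ (EuclideanSpace ℝ (Fin d) →ₘ[volume] ℂ) where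
  carrier := {f | (∀ γ : Γ, ∀ᵐ x, f (x + (γ : EuclideanSpace ℝ (Fin d))) =
      autFactor ν Γ χ γ x * f x) ∧
    IntegrableOn (fun x => ‖f x‖ ^ 2 * Real.exp (-ν * ‖x‖ ^ 2)) Λ}
  zero_mem' := by
    have h0 := AEEqFun.coeFn_zero (α := EuclideanSpace ℝ (Fin d)) (β := ℂ) (μ := volume)
    refine ⟨fun γ => ?_, ?_⟩
    · filter_upwards [h0, ae_shift h0 (γ : EuclideanSpace ℝ (Fin d))] with x h1 h2
      rw [h1, h2]; simp
    · refine (integrable_zero _ _ _).congr (ae_restrict_of_ae ?_)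
      filter_upwards [h0] with x h1
      rw [h1]; simp
  add_mem' := by
    rintro f g ⟨hf, hf'⟩ ⟨hg, hg'⟩
    have h0 := AEEqFun.coeFn_add f g
    refine ⟨fun γ => ?_, ?_⟩
    · filter_upwards [h0, ae_shift h0 (γ : EuclideanSpace ℝ (Fin d)), hf γ, hg γ]
        with x h1 h2 h3 h4
      rw [h1, h2, Pi.add_apply, Pi.add_apply, h3, h4, mul_add]
    · have hc : Continuous fun x : EuclideanSpace ℝ (Fin d) => Real.exp (-ν * ‖x‖ ^ 2) := by
        fun_prop
      refine Integrable.mono' ((hf'.const_mul 2).add (hg'.const_mul 2))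
        (((f + g).aestronglyMeasurable.norm.pow 2).mul hc.aestronglyMeasurable).restrict
        (ae_restrict_of_ae ?_)
      filter_upwards [h0] with x h1
      have he := Real.exp_pos (-ν * ‖x‖ ^ 2)
      rw [h1, Real.norm_eq_abs, abs_of_nonneg (by positivity)]
      simp only [Pi.add_apply]
      have h2 : ‖f x + g x‖ ^ 2 ≤ 2 * ‖f x‖ ^ 2 + 2 * ‖g x‖ ^ 2 := by
        nlinarith [norm_add_le (f x) (g x), norm_nonneg (f x + g x),
          sq_nonneg (‖f x‖ - ‖g x‖), norm_nonneg (f x), norm_nonneg (g x)]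
      nlinarith [mul_le_mul_of_nonneg_right h2 he.le]
  smul_mem' := by
    rintro c f ⟨hf, hf'⟩
    have h0 := AEEqFun.coeFn_smul c f
    refine ⟨fun γ => ?_, ?_⟩
    · filter_upwards [h0, ae_shift h0 (γ : EuclideanSpace ℝ (Fin d)), hf γ] with x h1 h2 h3
      rw [h1, h2, Pi.smul_apply, Pi.smul_apply, h3, smul_eq_mul, smul_eq_mul]; ring
    · refine (hf'.const_mul (‖c‖ ^ 2)).congr (ae_restrict_of_ae ?_)
      filter_upwards [h0] with x h1
      rw [h1, Pi.smul_apply, norm_smul]; ring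

/-- The scalar product `∫_Λ f(x) conj(g(x)) exp(-ν ‖x‖²) dx` of `f` and `g`. It is linear in `f`;
in Mathlib's convention (linear in the second argument) it is `inner ℂ g f`. -/
def thetaScalar {d : ℕ} (ν : ℝ) (Λ : Set (EuclideanSpace ℝ (Fin d)))
    (f g : EuclideanSpace ℝ (Fin d) → ℂ) : ℂ :=
  ∫ x in Λ, f x * conj (g x) * (Real.exp (-ν * ‖x‖ ^ 2) : ℂ)

lemma thetaScalar_self {d : ℕ} (ν : ℝ) (Λ : Set (EuclideanSpace ℝ (Fin d)))
    (f : EuclideanSpace ℝ (Fin d) → ℂ) :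
    thetaScalar ν Λ f f = ((∫ x in Λ, ‖f x‖ ^ 2 * Real.exp (-ν * ‖x‖ ^ 2) : ℝ) : ℂ) := by
  rw [thetaScalar, ← integral_complex_ofReal]
  refine integral_congr_ae (Filter.Eventually.of_forall fun x => ?_)
  simp only [Complex.mul_conj, Complex.normSq_eq_norm_sq]
  push_cast
  ring

/-- An element of the space that vanishes almost everywhere on the fundamental domain is zero. -/
lemma eq_zero_of_ae_zero {d : ℕ} (ν : ℝ) (Γ : AddSubgroup (EuclideanSpace ℝ (Fin d)))
    [DiscreteTopology Γ] (χ : Γ → Circle) {Λ : Set (EuclideanSpace ℝ (Fin d))}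
    (hΛ : IsAddFundamentalDomain Γ Λ volume) (f : thetaSpace ν Γ χ hΛ)
    (hf : ∀ᵐ x, x ∈ Λ → f.1 x = 0) : f = 0 := by
  have : Countable Γ := TopologicalSpace.separableSpace_iff_countable.mp inferInstance
  have h1 : ∀ᵐ x, ∀ γ : Γ, f.1 (x + (γ : EuclideanSpace ℝ (Fin d))) =
      autFactor ν Γ χ γ x * f.1 x := ae_all_iff.2 f.2.1
  have h2 : ∀ᵐ x, ∀ γ : Γ, x + (γ : EuclideanSpace ℝ (Fin d)) ∈ Λ →
      f.1 (x + (γ : EuclideanSpace ℝ (Fin d))) = 0 :=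
    ae_all_iff.2 fun γ => ae_shift hf (γ : EuclideanSpace ℝ (Fin d))
  refine Subtype.ext (AEEqFun.ext ?_)
  have h0 := AEEqFun.coeFn_zero (α := EuclideanSpace ℝ (Fin d)) (β := ℂ) (μ := volume)
  filter_upwards [h1, h2, hΛ.ae_covers, h0] with x h1 h2 h3 h4
  obtain ⟨γ, hγ⟩ := h3
  have h5 : x + (γ : EuclideanSpace ℝ (Fin d)) ∈ Λ := by
    rw [add_comm]; exact hγ
  have h6 := h2 γ h5
  rw [h1 γ] at h6
  rw [(mul_eq_zero.1 h6).resolve_left (autFactor_ne_zero _ _ _ _ _)]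
  exact h4.symm

/-- The scalar product makes the space an inner product space. -/
instance innerCore {d : ℕ} (ν : ℝ) (Γ : AddSubgroup (EuclideanSpace ℝ (Fin d)))
    [DiscreteTopology Γ] (χ : Γ → Circle) {Λ : Set (EuclideanSpace ℝ (Fin d))}
    (hΛ : IsAddFundamentalDomain Γ Λ volume) :
    InnerProductSpace.Core ℂ (thetaSpace ν Γ χ hΛ) where
  inner f g := thetaScalar ν Λ g.1 f.1
  conj_inner_symm f g := by
    simp only [thetaScalar]
    rw [← integral_conj]
    refine integral_congr_ae (Filter.Eventually.of_forall fun x => ?_)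
    simp only [map_mul, Complex.conj_conj, Complex.conj_ofReal]
    ring
  re_inner_nonneg f := by
    rw [thetaScalar_self]
    exact integral_nonneg fun x => by positivity
  add_left f g h := by
    simp only [thetaScalar]
    rw [← integral_add]
    · refine integral_congr_ae (ae_restrict_of_ae ?_)
      filter_upwards [AEEqFun.coeFn_add f.1 g.1] with x hx
      rw [Submodule.coe_add, hx, Pi.add_apply, map_add]
      ring
    · refine (integrableOn_conj_mul ν Λ f.1 h.1 f.2.2 h.2.2).congr
        (Filter.Eventually.of_forall fun x => ?_)
      simp only; ring
    · refine (integrableOn_conj_mul ν Λ g.1 h.1 g.2.2 h.2.2).congr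
        (Filter.Eventually.of_forall fun x => ?_)
      simp only; ring
  smul_left f g c := by
    simp only [thetaScalar]
    rw [← integral_const_mul]
    refine integral_congr_ae (ae_restrict_of_ae ?_)
    filter_upwards [AEEqFun.coeFn_smul c f.1] with x hx
    rw [Submodule.coe_smul, hx, Pi.smul_apply, smul_eq_mul, map_mul]
    ring
  definite f hf := by
    rw [thetaScalar_self] at hf
    have hf' : ∫ x in Λ, ‖f.1 x‖ ^ 2 * Real.exp (-ν * ‖x‖ ^ 2) = 0 := by exact_mod_cast hf
    rw [integral_eq_zero_iff_of_nonneg (fun x => by positivity) f.2.2] at hf'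
    refine eq_zero_of_ae_zero ν Γ χ hΛ f ?_
    have h1 := (ae_restrict_iff'₀ hΛ.nullMeasurableSet).1 hf'
    filter_upwards [h1] with x hx hxΛ
    have h2 := hx hxΛ
    simp only [Pi.zero_apply, mul_eq_zero, (Real.exp_pos _).ne', or_false] at h2
    exact norm_eq_zero.1 (pow_eq_zero_iff (two_ne_zero)|>.1 h2)

instance {d : ℕ} (ν : ℝ) (Γ : AddSubgroup (EuclideanSpace ℝ (Fin d)))
    [DiscreteTopology Γ] (χ : Γ → Circle) {Λ : Set (EuclideanSpace ℝ (Fin d))}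
    (hΛ : IsAddFundamentalDomain Γ Λ volume) : NormedAddCommGroup (thetaSpace ν Γ χ hΛ) :=
  (innerCore ν Γ χ hΛ).toNormedAddCommGroup

instance {d : ℕ} (ν : ℝ) (Γ : AddSubgroup (EuclideanSpace ℝ (Fin d)))
    [DiscreteTopology Γ] (χ : Γ → Circle) {Λ : Set (EuclideanSpace ℝ (Fin d))}
    (hΛ : IsAddFundamentalDomain Γ Λ volume) : InnerProductSpace ℂ (thetaSpace ν Γ χ hΛ) :=
  InnerProductSpace.ofCore (innerCore ν Γ χ hΛ).toCore

lemma inner_eq {d : ℕ} (ν : ℝ) (Γ : AddSubgroup (EuclideanSpace ℝ (Fin d)))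
    [DiscreteTopology Γ] (χ : Γ → Circle) {Λ : Set (EuclideanSpace ℝ (Fin d))}
    (hΛ : IsAddFundamentalDomain Γ Λ volume) (f g : thetaSpace ν Γ χ hΛ) :
    inner ℂ g f = thetaScalar ν Λ f.1 g.1 := rfl

lemma norm_sq_eq {d : ℕ} (ν : ℝ) (Γ : AddSubgroup (EuclideanSpace ℝ (Fin d)))
    [DiscreteTopology Γ] (χ : Γ → Circle) {Λ : Set (EuclideanSpace ℝ (Fin d))}
    (hΛ : IsAddFundamentalDomain Γ Λ volume) (f : thetaSpace ν Γ χ hΛ) :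
    ‖f‖ ^ 2 = ∫ x in Λ, ‖f.1 x‖ ^ 2 * Real.exp (-ν * ‖x‖ ^ 2) := by
  rw [← inner_self_eq_norm_sq (𝕜 := ℂ) f, inner_eq, thetaScalar_self]
  exact Complex.ofReal_re _

/-- The partial derivative of `f` with respect to the `i`-th coordinate. -/
def partialDeriv {m : ℕ} (i : Fin m) (f : (Fin m → ℝ) → ℝ) : (Fin m → ℝ) → ℝ :=
  fun ξ => deriv (fun t => f (Function.update ξ i t)) (ξ i)

/-- The mixed partial derivative `∂^k f`, with `k i` derivatives in the `i`-th coordinate. -/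
def mixedPartial {m : ℕ} (k : Fin m → ℕ) (f : (Fin m → ℝ) → ℝ) : (Fin m → ℝ) → ℝ :=
  (List.finRange m).foldr (fun i g => (partialDeriv i)^[k i] g) f

/-- The `m`-dimensional Hermite polynomial `H_k(ξ) = (-1)^|k| exp(‖ξ‖²) ∂^k exp(-‖ξ‖²)`. -/
def hermite {m : ℕ} (k : Fin m → ℕ) (ξ : Fin m → ℝ) : ℝ :=
  (-1) ^ (∑ i, k i) * Real.exp (∑ i, ξ i ^ 2) *
    mixedPartial k (fun η => Real.exp (-∑ i, η i ^ 2)) ξ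

/-- The function `x ↦ exp(ν ⟨x₁, x₁⟩ / 2 + 2 π i ⟨v + y, x₁⟩) H_k(√ν x₂)`, where `x = x₁ + x₂` with
`x₁` in `V_Γ` and `x₂` in its orthogonal complement, and where `x₂` is identified with its
coordinates in the orthonormal basis `w`. -/
def basisFun {d m : ℕ} (ν : ℝ) (Γ : AddSubgroup (EuclideanSpace ℝ (Fin d)))
    (w : OrthonormalBasis (Fin m) ℝ (realSpan Γ)ᗮ) (v y : EuclideanSpace ℝ (Fin d))
    (k : Fin m → ℕ) (x : EuclideanSpace ℝ (Fin d)) : ℂ :=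
  let x₁ : EuclideanSpace ℝ (Fin d) := (realSpan Γ).starProjection x
  let x₂ : (realSpan Γ)ᗮ := (realSpan Γ)ᗮ.orthogonalProjectionOnto x
  Complex.exp (((ν / 2 * inner ℝ x₁ x₁ : ℝ) : ℂ) +
      2 * (Real.pi : ℂ) * Complex.I * ((inner ℝ (v + y) x₁ : ℝ) : ℂ)) *
    (hermite k (fun j => Real.sqrt ν * w.repr x₂ j) : ℂ)

/-- An orthogonal basis of an inner product space: nonzero pairwise orthogonal vectors whose linear
span is dense. -/
structure IsOrthogonalBasis {ι H : Type*} [NormedAddCommGroup H] [InnerProductSpace ℂ H]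
    (e : ι → H) : Prop where
  ne_zero : ∀ i, e i ≠ 0
  orthogonal : Pairwise fun i j => inner ℂ (e i) (e j) = 0
  dense_span : (Submodule.span ℂ (Set.range e)).topologicalClosure = ⊤

end

end LikewiseTheta

/-!
Let `r` be the rank of `Γ` and `m = d - r`. A basis of `Γ` is a real basis of `V_Γ`
(`exists_basis_mem_iff`), so coordinates modulo `1` of `x₁` together with orthonormal coordinates of
`x₂` identify `ℝ^d / Γ` with `(ℝ/ℤ)^r × ℝ^m` (`quotientMap`). Translating a fundamental domain gives
another one, hence Lebesgue measure on `Λ₁` is pushed to a translation invariant measure of mass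
`vol Λ₁` on the torus, and Lebesgue measure on `Λ` is pushed to `vol Λ₁` times the product of the
normalized Haar measure and Lebesgue measure (`map_quotientMap_restrict`).

The function `thetaWeight`, `x ↦ exp (ν ‖x‖² / 2 + 2πi ⟨v, x⟩)`, vanishes nowhere, has the factor of
automorphy `χ(γ) exp (ν ⟨x + γ/2, γ⟩)`, and `|thetaWeight|² exp (-ν ‖x‖²) = 1`. Division by it
therefore turns theta functions into periodic functions and is an isometry of the theta space onto
`L²` of the quotient (`exists_linearIsometryEquiv_thetaSpace`); in particular the theta space is
complete. Under this isometry the function `e_{γ*,k}` corresponds to the product of the Fourier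
monomial of frequency `(⟨γ*, b_i⟩)_i` and of the Hermite functions `H_{k_j}(√ν y_j) exp (-ν y_j² / 2)`
(`basisFun_eq`), and the frequencies run through all of `ℤ^r` (`exists_equiv_dualLattice`).

Orthogonality and the norms follow from Fubini, the orthogonality of the Fourier monomials, and
integration by parts for Hermite polynomials (`integral_hermitePoly_mul`). For totality, let `h` be
orthogonal to all these products. Then `h(t, y) exp (-ν |y|² / 2)` is orthogonal to all products of a
Fourier monomial and a polynomial in `y`, hence, expanding `exp (i ξ_j y_j)` in power series under a
dominated limit, all its Fourier coefficients vanish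
(`integral_torusChar_mul_gaussian_mul_eq_zero`). The characters of `(ℝ/ℤ)^r × ℝ^m` span a star
algebra that separates points, and such an algebra determines finite measures; so `h` vanishes
almost everywhere (`ae_eq_zero_of_forall_integral_torusChar`).

When `m = 0` nothing is assumed on `ν`; the hypothesis `∀ _ : Fin m, 0 < ν` below means that `ν` is
positive unless `m = 0`.
-/

namespace LikewiseTheta

/-! ### Hermite polynomials and Hermite functions -/

open Polynomial in
/-- The one-dimensional (physicists') Hermite polynomial, given by `H₀ = 1` and
`H_{k+1} = 2 X H_k - H_k'`. -/
noncomputable def hermitePoly : ℕ → ℝ[X]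
  | 0 => 1
  | k + 1 => 2 * X * hermitePoly k - derivative (hermitePoly k)

open Polynomial in
theorem derivative_hermitePoly_succ (k : ℕ) :
    derivative (hermitePoly (k + 1)) = C (2 * ((k : ℝ) + 1)) * hermitePoly k := by
  induction k with
  | zero =>
    simp [hermitePoly, derivative_mul, C_ofNat]
  | succ k ih =>
    have h1 : hermitePoly (k + 2) = 2 * X * hermitePoly (k + 1) - derivative (hermitePoly (k + 1)) :=
      rfl
    have h2 : hermitePoly (k + 1) = 2 * X * hermitePoly k - derivative (hermitePoly k) := rfl
    rw [h1, ih, derivative_sub, derivative_mul, derivative_mul, derivative_C_mul, ih]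
    simp only [derivative_X, derivative_ofNat, C_mul, C_add, map_natCast, C_1, Nat.cast_add,
      Nat.cast_one, C_ofNat]
    rw [h2]
    ring

theorem iterate_deriv_exp_neg_sq (k : ℕ) :
    deriv^[k] (fun t : ℝ => Real.exp (-t ^ 2)) =
      fun t => (-1) ^ k * ((hermitePoly k).eval t * Real.exp (-t ^ 2)) := by
  induction k with
  | zero => simp [hermitePoly]
  | succ k ih =>
    rw [Function.iterate_succ_apply', ih]
    funext t
    have h1 : HasDerivAt (fun t : ℝ => Real.exp (-t ^ 2)) (Real.exp (-t ^ 2) * (-(2 * t))) t := by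
      have := ((hasDerivAt_pow 2 t).neg).exp
      simpa using this
    rw [((((hermitePoly k).hasDerivAt t).fun_mul h1).const_mul ((-1 : ℝ) ^ k)).deriv]
    simp only [hermitePoly, Polynomial.eval_sub, Polynomial.eval_mul, Polynomial.eval_X,
      Polynomial.eval_ofNat]
    ring

theorem iterate_partialDeriv_prod {m : ℕ} (i : Fin m) (n : ℕ) (g : Fin m → ℝ → ℝ) :
    (partialDeriv i)^[n] (fun η => ∏ j, g j (η j)) =
      fun η => ∏ j, Function.update g i (deriv^[n] (g i)) j (η j) := by
  induction n with
  | zero => simp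
  | succ n ih =>
    rw [Function.iterate_succ_apply', ih]
    funext η
    simp only [partialDeriv]
    have key : ∀ (F : ℝ → ℝ) (ζ : Fin m → ℝ), ∏ j, Function.update g i F j (ζ j) =
        (∏ j ∈ Finset.univ.erase i, g j (ζ j)) * F (ζ i) := by
      intro F ζ
      rw [← Finset.prod_erase_mul _ _ (Finset.mem_univ i), Function.update_self]
      congr 1
      refine Finset.prod_congr rfl fun j hj => ?_
      rw [Function.update_of_ne (Finset.ne_of_mem_erase hj)]
    simp only [key, Function.update_self]
    have : ∀ t : ℝ, (∏ j ∈ Finset.univ.erase i, g j (Function.update η i t j)) =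
        ∏ j ∈ Finset.univ.erase i, g j (η j) := fun t =>
      Finset.prod_congr rfl fun j hj => by
        rw [Function.update_of_ne (Finset.ne_of_mem_erase hj)]
    simp only [this, deriv_const_mul_field, Function.iterate_succ_apply']

theorem foldr_partialDeriv_prod {m : ℕ} (k : Fin m → ℕ) (g : Fin m → ℝ → ℝ) (l : List (Fin m))
    (hl : l.Nodup) :
    l.foldr (fun i f => (partialDeriv i)^[k i] f) (fun η => ∏ j, g j (η j)) =
      fun η => ∏ j, (if j ∈ l then deriv^[k j] (g j) else g j) (η j) := by
  induction l with
  | nil => simp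
  | cons i l ih =>
    rw [List.foldr_cons, ih hl.of_cons, iterate_partialDeriv_prod]
    funext η
    refine Finset.prod_congr rfl fun j _ => ?_
    have hi : i ∉ l := (List.nodup_cons.1 hl).1
    by_cases hj : j = i
    · subst hj; simp [hi]
    · simp [hj]

/-- The multivariate Hermite polynomial is a product of one-dimensional ones. -/
theorem hermite_eq_prod {m : ℕ} (k : Fin m → ℕ) (ξ : Fin m → ℝ) :
    hermite k ξ = ∏ i, (hermitePoly (k i)).eval (ξ i) := by
  have h1 : (fun η : Fin m → ℝ => Real.exp (-∑ i, η i ^ 2)) =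
      fun η => ∏ j, (fun t : ℝ => Real.exp (-t ^ 2)) (η j) := by
    funext η
    rw [← Finset.sum_neg_distrib, Real.exp_sum]
  rw [hermite, mixedPartial, h1,
    foldr_partialDeriv_prod k (fun _ t => Real.exp (-t ^ 2)) _ (List.nodup_finRange m)]
  simp only [List.mem_finRange, if_true, iterate_deriv_exp_neg_sq, Finset.prod_mul_distrib]
  rw [← Real.exp_sum, Finset.sum_neg_distrib, Finset.prod_pow_eq_pow_sum, Real.exp_neg]
  have h2 := (Real.exp_pos (∑ i, ξ i ^ 2)).ne'
  have h3 : ((-1 : ℝ) ^ ∑ i, k i) * (-1) ^ ∑ i, k i = 1 := by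
    rw [← mul_pow]; simp
  field_simp
  rw [sq, h3, one_mul]

theorem integrable_polynomial_mul_exp_neg_sq (p : Polynomial ℝ) :
    Integrable fun t : ℝ => p.eval t * Real.exp (-t ^ 2) := by
  induction p using Polynomial.induction_on' with
  | add p q hp hq => simpa only [Polynomial.eval_add, add_mul] using! hp.add hq
  | monomial n a =>
    have h := integrable_rpow_mul_exp_neg_mul_sq (b := 1) one_pos (s := n)
      (by have : (0 : ℝ) ≤ n := Nat.cast_nonneg n
          linarith)
    simpa [mul_assoc] using h.const_mul a

/-- Integration by parts: since `(H_k exp(-t²))' = -H_{k+1} exp(-t²)`, the passage from `H_k` to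
`H_{k+1}` is adjoint to the derivative. -/
theorem integral_hermitePoly_succ_mul (k : ℕ) (q : Polynomial ℝ) :
    ∫ t : ℝ, (hermitePoly (k + 1)).eval t * q.eval t * Real.exp (-t ^ 2) =
      ∫ t : ℝ, (hermitePoly k).eval t * (Polynomial.derivative q).eval t * Real.exp (-t ^ 2) := by
  have hv : ∀ t : ℝ, HasDerivAt (fun t => (hermitePoly k).eval t * Real.exp (-t ^ 2))
      (-((hermitePoly (k + 1)).eval t * Real.exp (-t ^ 2))) t := by
    intro t
    have h1 : HasDerivAt (fun t : ℝ => Real.exp (-t ^ 2)) (Real.exp (-t ^ 2) * (-(2 * t))) t := by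
      have := ((hasDerivAt_pow 2 t).neg).exp
      simpa using this
    refine (((hermitePoly k).hasDerivAt t).fun_mul h1).congr_deriv ?_
    simp only [hermitePoly, Polynomial.eval_sub, Polynomial.eval_mul, Polynomial.eval_X,
      Polynomial.eval_ofNat]
    ring
  have h := integral_mul_deriv_eq_deriv_mul_of_integrable
    (u := fun t => q.eval t) (v := fun t => (hermitePoly k).eval t * Real.exp (-t ^ 2))
    (fun t _ => q.hasDerivAt t) (fun t _ => hv t)
    (((integrable_polynomial_mul_exp_neg_sq (q * hermitePoly (k + 1))).neg).congr
      (Filter.Eventually.of_forall fun t => by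
        simp only [Pi.neg_apply, Pi.mul_apply, Polynomial.eval_mul]; ring))
    ((integrable_polynomial_mul_exp_neg_sq (Polynomial.derivative q * hermitePoly k)).congr
      (Filter.Eventually.of_forall fun t => by
        simp only [Pi.mul_apply, Polynomial.eval_mul]; ring))
    ((integrable_polynomial_mul_exp_neg_sq (q * hermitePoly k)).congr
      (Filter.Eventually.of_forall fun t => by
        simp only [Pi.mul_apply, Polynomial.eval_mul]; ring))
  have h2 := congrArg Neg.neg h
  rw [neg_neg, ← integral_neg] at h2
  convert! h2 using 3 <;> ring

theorem integral_hermitePoly_mul (j k : ℕ) :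
    ∫ t : ℝ, (hermitePoly j).eval t * (hermitePoly k).eval t * Real.exp (-t ^ 2) =
      if j = k then Real.sqrt Real.pi * 2 ^ k * (k.factorial : ℝ) else 0 := by
  induction j generalizing k with
  | zero =>
    cases k with
    | zero =>
      have := integral_gaussian 1
      simpa [hermitePoly] using this
    | succ k =>
      have h := integral_hermitePoly_succ_mul k (hermitePoly 0)
      simp only [hermitePoly, Polynomial.derivative_one, Polynomial.eval_zero, mul_zero, zero_mul,
        integral_zero] at h
      simp only [(Nat.succ_ne_zero k).symm, if_false]
      simpa [hermitePoly, mul_comm] using h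
  | succ j ih =>
    rw [integral_hermitePoly_succ_mul]
    cases k with
    | zero => simp [hermitePoly]
    | succ k =>
      rw [derivative_hermitePoly_succ]
      have : ∀ t : ℝ, (hermitePoly j).eval t *
          (Polynomial.C (2 * ((k : ℝ) + 1)) * hermitePoly k).eval t * Real.exp (-t ^ 2) =
          (2 * ((k : ℝ) + 1)) *
            ((hermitePoly j).eval t * (hermitePoly k).eval t * Real.exp (-t ^ 2)) := by
        intro t
        simp only [Polynomial.eval_mul, Polynomial.eval_C]
        ring
      simp only [this]
      rw [integral_const_mul, ih]
      by_cases hjk : j = k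
      · simp only [hjk, if_true, Nat.factorial_succ]
        push_cast
        ring
      · simp [hjk]

/-- The Hermite function `t ↦ H_k(√ν t) exp(-ν t² / 2)`. -/
noncomputable def hermiteFun (ν : ℝ) (k : ℕ) (t : ℝ) : ℝ :=
  (hermitePoly k).eval (Real.sqrt ν * t) * Real.exp (-(ν / 2) * t ^ 2)

theorem continuous_hermiteFun (ν : ℝ) (k : ℕ) : Continuous (hermiteFun ν k) := by
  unfold hermiteFun
  have := (hermitePoly k).continuous
  fun_prop

theorem hermiteFun_mul {ν : ℝ} (hν : 0 < ν) (j k : ℕ) (t : ℝ) :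
    hermiteFun ν j t * hermiteFun ν k t =
      (hermitePoly j).eval (Real.sqrt ν * t) * (hermitePoly k).eval (Real.sqrt ν * t) *
        Real.exp (-(Real.sqrt ν * t) ^ 2) := by
  have : Real.exp (-(Real.sqrt ν * t) ^ 2) =
      Real.exp (-(ν / 2) * t ^ 2) * Real.exp (-(ν / 2) * t ^ 2) := by
    rw [← Real.exp_add, mul_pow, Real.sq_sqrt hν.le]
    congr 1
    ring
  rw [this, hermiteFun, hermiteFun]
  ring

theorem integrable_hermiteFun_mul {ν : ℝ} (hν : 0 < ν) (j k : ℕ) :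
    Integrable fun t => hermiteFun ν j t * hermiteFun ν k t := by
  simp only [hermiteFun_mul hν]
  have h := (integrable_polynomial_mul_exp_neg_sq (hermitePoly j * hermitePoly k)).comp_mul_left'
    (Real.sqrt_pos.2 hν).ne'
  simpa only [Polynomial.eval_mul] using h

theorem integral_hermiteFun_mul {ν : ℝ} (hν : 0 < ν) (j k : ℕ) :
    ∫ t, hermiteFun ν j t * hermiteFun ν k t =
      if j = k then (Real.pi / ν) ^ ((1 : ℝ) / 2) * 2 ^ k * (k.factorial : ℝ) else 0 := by
  simp only [hermiteFun_mul hν]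
  rw [Measure.integral_comp_mul_left (fun t => (hermitePoly j).eval t * (hermitePoly k).eval t *
    Real.exp (-t ^ 2)), integral_hermitePoly_mul, abs_of_nonneg (by positivity),
    ← Real.sqrt_eq_rpow, Real.sqrt_div' _ hν.le]
  split_ifs
  · rw [smul_eq_mul]; ring
  · simp

/-- Multiplication by `t` preserves the span of the rescaled Hermite polynomials. -/
theorem mul_mem_span_hermitePoly {ν : ℝ} (hν : 0 < ν) (g : ℝ → ℂ)
    (hg : g ∈ Submodule.span ℂ (Set.range fun (k : ℕ) (t : ℝ) =>
      (((hermitePoly k).eval (Real.sqrt ν * t) : ℝ) : ℂ))) :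
    (fun t : ℝ => (t : ℂ) * g t) ∈ Submodule.span ℂ (Set.range fun (k : ℕ) (t : ℝ) =>
      (((hermitePoly k).eval (Real.sqrt ν * t) : ℝ) : ℂ)) := by
  induction hg using Submodule.span_induction with
  | zero => simp only [Pi.zero_apply, mul_zero]; exact Submodule.zero_mem _
  | add f g _ _ hf hg => simpa only [Pi.add_apply, mul_add] using! Submodule.add_mem _ hf hg
  | smul c f _ hf =>
    convert! Submodule.smul_mem _ c hf using 1
    funext t
    simp only [Pi.smul_apply, smul_eq_mul]
    ring
  | mem f hf =>
    obtain ⟨k, rfl⟩ := hf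
    have hs : ((Real.sqrt ν : ℝ) : ℂ) ≠ 0 := by exact_mod_cast (Real.sqrt_pos.2 hν).ne'
    have hmem := fun k : ℕ => Submodule.subset_span (R := ℂ)
      (s := Set.range fun (k : ℕ) (t : ℝ) => (((hermitePoly k).eval (Real.sqrt ν * t) : ℝ) : ℂ))
      (Set.mem_range_self k)
    cases k with
    | zero =>
      convert! Submodule.smul_mem _ (1 / (2 * ((Real.sqrt ν : ℝ) : ℂ))) (hmem 1) using 1
      funext t
      simp only [hermitePoly, Polynomial.eval_sub, Polynomial.eval_mul, Polynomial.eval_X,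
        Polynomial.eval_ofNat, Polynomial.eval_one, Polynomial.derivative_one, Polynomial.eval_zero,
        Pi.smul_apply, smul_eq_mul]
      push_cast
      field_simp
      ring
    | succ k =>
      -- the three-term recurrence `2 X H_{k+1} = H_{k+2} + 2 (k+1) H_k`
      convert! Submodule.smul_mem _ (1 / (2 * ((Real.sqrt ν : ℝ) : ℂ))) (Submodule.add_mem _
        (hmem (k + 2)) (Submodule.smul_mem _ (2 * ((k : ℂ) + 1)) (hmem k))) using 1
      funext t
      have h1 : hermitePoly (k + 2) =
        2 * Polynomial.X * hermitePoly (k + 1) - Polynomial.derivative (hermitePoly (k + 1)) := rfl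
      simp only [h1, derivative_hermitePoly_succ, Polynomial.eval_sub, Polynomial.eval_mul,
        Polynomial.eval_X, Polynomial.eval_C, Polynomial.eval_ofNat, Pi.add_apply,
        Pi.smul_apply, smul_eq_mul]
      push_cast
      field_simp
      ring

theorem pow_mem_span_hermitePoly {ν : ℝ} (hν : 0 < ν) (n : ℕ) :
    (fun t : ℝ => (t : ℂ) ^ n) ∈ Submodule.span ℂ (Set.range fun (k : ℕ) (t : ℝ) =>
      (((hermitePoly k).eval (Real.sqrt ν * t) : ℝ) : ℂ)) := by
  induction n with
  | zero => exact Submodule.subset_span ⟨0, by funext t; simp [hermitePoly]⟩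
  | succ n ih =>
    simp only [pow_succ']
    exact mul_mem_span_hermitePoly hν _ ih

/-- A partial sum of the power series of `exp (z t)` is a combination of the rescaled Hermite
polynomials. -/
theorem exists_partialSum_exp_eq {ν : ℝ} (hν : 0 < ν) (z : ℂ) (N : ℕ) :
    ∃ c : ℕ →₀ ℂ, ∀ t : ℝ, ∑ n ∈ Finset.range N, (z * t) ^ n / (n.factorial : ℂ) =
      ∑ k ∈ c.support, c k * (((hermitePoly k).eval (Real.sqrt ν * t) : ℝ) : ℂ) := by
  have h : (∑ n ∈ Finset.range N, (z ^ n / (n.factorial : ℂ)) • fun t : ℝ => (t : ℂ) ^ n) ∈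
      Submodule.span ℂ (Set.range fun (k : ℕ) (t : ℝ) =>
      (((hermitePoly k).eval (Real.sqrt ν * t) : ℝ) : ℂ)) :=
    Submodule.sum_mem _ fun n _ => Submodule.smul_mem _ _ (pow_mem_span_hermitePoly hν n)
  obtain ⟨c, hc⟩ := (Finsupp.mem_span_range_iff_exists_finsupp).1 h
  refine ⟨c, fun t => ?_⟩
  have h2 := congrFun hc t
  simp only [Finsupp.sum, Finset.sum_apply, Pi.smul_apply, smul_eq_mul] at h2
  rw [h2]
  refine Finset.sum_congr rfl fun n _ => ?_
  ring

/-! ### Uniqueness of Fourier coefficients on the product of a torus and a Euclidean space -/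

open BoundedContinuousFunction

/-- A real integrable function that integrates to zero against a point-separating star algebra of
bounded continuous functions vanishes almost everywhere: its positive and negative parts are
densities of the same finite measure. -/
theorem ae_eq_zero_of_forall_integral_mul_ofReal_eq_zero {X : Type*} [TopologicalSpace X]
    [PolishSpace X] [MeasurableSpace X] [BorelSpace X] {σ : Measure X} {u : X → ℝ}
    (hu : Integrable u σ) {A : StarSubalgebra ℂ (X →ᵇ ℂ)}
    (hA : (A.map (toContinuousMapStarₐ ℂ)).SeparatesPoints)
    (h : ∀ g ∈ A, ∫ x, g x * (u x : ℂ) ∂σ = 0) : u =ᵐ[σ] 0 := by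
  have hfin : IsFiniteMeasure (σ.withDensity fun x => ENNReal.ofReal (u x)) :=
    isFiniteMeasure_withDensity_ofReal hu.2
  have hfin' : IsFiniteMeasure (σ.withDensity fun x => ENNReal.ofReal (-u x)) :=
    isFiniteMeasure_withDensity_ofReal hu.neg.2
  have hm : AEMeasurable (fun x => ENNReal.ofReal (u x)) σ := hu.1.aemeasurable.ennreal_ofReal
  have hm' : AEMeasurable (fun x => ENNReal.ofReal (-u x)) σ := hu.neg.1.aemeasurable.ennreal_ofReal
  have key : (σ.withDensity fun x => ENNReal.ofReal (u x)) =
      σ.withDensity fun x => ENNReal.ofReal (-u x) := by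
    refine ext_of_forall_mem_subalgebra_integral_eq_of_polish hA fun g hg => ?_
    rw [integral_withDensity_eq_integral_toReal_smul₀ hm (by simp),
      integral_withDensity_eq_integral_toReal_smul₀ hm' (by simp), ← sub_eq_zero, ← integral_sub]
    · rw [← h g hg]
      refine integral_congr_ae (Filter.Eventually.of_forall fun x => ?_)
      simp only [ENNReal.toReal_ofReal', real_smul]
      rw [← sub_mul, ← ofReal_sub, mul_comm, max_zero_sub_max_neg_zero_eq_self]
    · have := hu.pos_part.ofReal (𝕜 := ℂ)
      refine (this.mul_bdd (c := ‖g‖) g.continuous.aestronglyMeasurable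
        (Filter.Eventually.of_forall fun x => g.norm_coe_le_norm x)).congr
        (Filter.Eventually.of_forall fun x => ?_)
      simp [ENNReal.toReal_ofReal']
    · have := hu.neg.pos_part.ofReal (𝕜 := ℂ)
      refine (this.mul_bdd (c := ‖g‖) g.continuous.aestronglyMeasurable
        (Filter.Eventually.of_forall fun x => g.norm_coe_le_norm x)).congr
        (Filter.Eventually.of_forall fun x => ?_)
      simp [ENNReal.toReal_ofReal']
  have h2 := (withDensity_eq_iff hm hm' (by
    exact (hu.lintegral_lt_top).ne)).1 key
  filter_upwards [h2] with x hx
  rcases le_total (u x) 0 with h0 | h0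
  · rw [ENNReal.ofReal_of_nonpos h0] at hx
    have := ENNReal.ofReal_eq_zero.1 hx.symm
    simp only [Pi.zero_apply]
    linarith
  · rw [ENNReal.ofReal_of_nonpos (neg_nonpos.2 h0)] at hx
    have := ENNReal.ofReal_eq_zero.1 hx
    simp only [Pi.zero_apply]
    linarith

/-- An integrable function that integrates to zero against a point-separating star algebra of
bounded continuous functions vanishes almost everywhere. -/
theorem ae_eq_zero_of_forall_integral_mul_eq_zero {X : Type*} [TopologicalSpace X]
    [PolishSpace X] [MeasurableSpace X] [BorelSpace X] {σ : Measure X} {F : X → ℂ}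
    (hF : Integrable F σ) {A : StarSubalgebra ℂ (X →ᵇ ℂ)}
    (hA : (A.map (toContinuousMapStarₐ ℂ)).SeparatesPoints)
    (h : ∀ g ∈ A, ∫ x, g x * F x ∂σ = 0) : F =ᵐ[σ] 0 := by
  have hint : ∀ g : X →ᵇ ℂ, Integrable (fun x => g x * F x) σ := fun g =>
    hF.bdd_mul (c := ‖g‖) g.continuous.aestronglyMeasurable
      (Filter.Eventually.of_forall fun x => g.norm_coe_le_norm x)
  have hconj : ∀ g ∈ A, ∫ x, g x * conj (F x) ∂σ = 0 := by
    intro g hg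
    have h1 := h (star g) (star_mem hg)
    have h2 := congrArg conj h1
    rw [← integral_conj, map_zero] at h2
    rw [← h2]
    refine integral_congr_ae (Filter.Eventually.of_forall fun x => ?_)
    simp
  have hint' : ∀ g : X →ᵇ ℂ, Integrable (fun x => g x * conj (F x)) σ := fun g =>
    (hF.congr' (g := fun x => conj (F x)) (continuous_conj.comp_aestronglyMeasurable hF.1)
      (by simp)).bdd_mul (c := ‖g‖) g.continuous.aestronglyMeasurable
      (Filter.Eventually.of_forall fun x => g.norm_coe_le_norm x)
  have hre : (fun x => (F x).re) =ᵐ[σ] 0 := by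
    refine ae_eq_zero_of_forall_integral_mul_ofReal_eq_zero hF.re hA fun g hg => ?_
    have : ∀ x, g x * (((F x).re : ℝ) : ℂ) =
        (1 / 2 : ℂ) * (g x * F x + g x * conj (F x)) := by
      intro x
      rw [← mul_add, add_conj]
      simp
      ring
    simp only [this]
    rw [integral_const_mul, integral_add (hint g) (hint' g), h g hg, hconj g hg]
    simp
  have him : (fun x => (F x).im) =ᵐ[σ] 0 := by
    refine ae_eq_zero_of_forall_integral_mul_ofReal_eq_zero hF.im hA fun g hg => ?_
    have : ∀ x, g x * (((F x).im : ℝ) : ℂ) =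
        (1 / (2 * I) : ℂ) * (g x * F x - g x * conj (F x)) := by
      intro x
      rw [← mul_sub, sub_conj]
      field_simp
      push_cast
      ring
    simp only [this]
    rw [integral_const_mul, integral_sub (hint g) (hint' g), h g hg, hconj g hg]
    simp
  filter_upwards [hre, him] with x h1 h2
  exact Complex.ext h1 h2

/-- The normalized Haar measure of the torus `(ℝ/ℤ)^r`. -/
noncomputable abbrev torusMeasure (r : ℕ) : Measure (UnitAddTorus (Fin r)) :=
  Measure.pi fun _ => AddCircle.haarAddCircle

/-- The character `(t, y) ↦ exp (2πi ⟨n, t⟩) exp (i ⟨ξ, y⟩)` of `(ℝ/ℤ)^r × ℝ^m`. -/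
noncomputable def torusChar {r m : ℕ} (n : Fin r → ℤ) (ξ : Fin m → ℝ) :
    (UnitAddTorus (Fin r) × (Fin m → ℝ)) →ᵇ ℂ :=
  BoundedContinuousFunction.ofNormedAddCommGroup
    (fun p => UnitAddTorus.mFourier n p.1 * ∏ i, exp (I * ξ i * p.2 i))
    (by fun_prop) 1 (fun p => by
      have h1 : ‖UnitAddTorus.mFourier n p.1‖ ≤ 1 :=
        ((UnitAddTorus.mFourier n).norm_coe_le_norm p.1).trans UnitAddTorus.mFourier_norm.le
      have h2 : ‖∏ i, exp (I * ξ i * p.2 i)‖ = 1 := by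
        rw [norm_prod]
        refine Finset.prod_eq_one fun i _ => ?_
        rw [mul_assoc, ← ofReal_mul, mul_comm, norm_exp_ofReal_mul_I]
      rw [norm_mul, h2, mul_one]
      exact h1)

theorem torusChar_apply {r m : ℕ} (n : Fin r → ℤ) (ξ : Fin m → ℝ)
    (p : UnitAddTorus (Fin r) × (Fin m → ℝ)) :
    torusChar n ξ p = UnitAddTorus.mFourier n p.1 * ∏ i, exp (I * ξ i * p.2 i) := rfl

theorem torusChar_mul {r m : ℕ} (n n' : Fin r → ℤ) (ξ ξ' : Fin m → ℝ) :
    torusChar n ξ * torusChar n' ξ' = torusChar (n + n') (ξ + ξ') := by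
  ext p
  simp only [BoundedContinuousFunction.mul_apply, torusChar_apply, UnitAddTorus.mFourier_add,
    Pi.add_apply, ofReal_add, mul_add, add_mul, exp_add, Finset.prod_mul_distrib]
  ring

theorem torusChar_zero {r m : ℕ} :
    (torusChar 0 0 : (UnitAddTorus (Fin r) × (Fin m → ℝ)) →ᵇ ℂ) = 1 := by
  ext p
  simp [torusChar_apply, UnitAddTorus.mFourier_zero]

theorem star_torusChar {r m : ℕ} (n : Fin r → ℤ) (ξ : Fin m → ℝ) :
    star (torusChar n ξ) = torusChar (-n) (-ξ) := by
  ext p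
  change conj (torusChar n ξ p) = _
  simp only [torusChar_apply, UnitAddTorus.mFourier_neg, map_prod, ← exp_conj, map_mul, conj_I,
    conj_ofReal, Pi.neg_apply, ofReal_neg, neg_mul, mul_neg]

/-- The star algebra of trigonometric polynomials on `(ℝ/ℤ)^r × ℝ^m`. -/
noncomputable def torusCharAlgebra (r m : ℕ) :
    StarSubalgebra ℂ ((UnitAddTorus (Fin r) × (Fin m → ℝ)) →ᵇ ℂ) where
  toSubalgebra := Algebra.adjoin ℂ (Set.range fun q : (Fin r → ℤ) × (Fin m → ℝ) =>
    torusChar q.1 q.2)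
  star_mem' := by
    change Algebra.adjoin ℂ _ ≤ star (Algebra.adjoin ℂ _)
    refine Algebra.adjoin_le ?_
    rintro _ ⟨q, rfl⟩
    refine Algebra.subset_adjoin ⟨(-q.1, -q.2), ?_⟩
    exact (star_torusChar q.1 q.2).symm

theorem torusCharAlgebra_separatesPoints (r m : ℕ) :
    ((torusCharAlgebra r m).map (toContinuousMapStarₐ ℂ)).SeparatesPoints := by
  have hmem : ∀ (n : Fin r → ℤ) (ξ : Fin m → ℝ), torusChar n ξ ∈ torusCharAlgebra r m :=
    fun n ξ => Algebra.subset_adjoin ⟨(n, ξ), rfl⟩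
  rintro ⟨s, y⟩ ⟨t, z⟩ hne
  suffices h : ∃ (n : Fin r → ℤ) (ξ : Fin m → ℝ), torusChar n ξ (s, y) ≠ torusChar n ξ (t, z) by
    obtain ⟨n, ξ, h⟩ := h
    exact ⟨_, ⟨toContinuousMapStarₐ ℂ (torusChar n ξ), ⟨_, hmem n ξ, rfl⟩, rfl⟩, h⟩
  by_cases hst : s = t
  · have hyz : y ≠ z := fun h => hne (by rw [hst, h])
    obtain ⟨i, hi⟩ := Function.ne_iff.1 hyz
    -- a frequency for which the phases at `y i` and `z i` differ by `π`
    refine ⟨0, Pi.single i (Real.pi / (y i - z i)), ?_⟩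
    have hv : ∀ p : UnitAddTorus (Fin r) × (Fin m → ℝ),
        torusChar 0 (Pi.single i (Real.pi / (y i - z i))) p =
          exp (I * ((Real.pi / (y i - z i) : ℝ) : ℂ) * p.2 i) := by
      intro p
      rw [torusChar_apply, UnitAddTorus.mFourier_zero, Finset.prod_eq_single i]
      · simp
      · intro j _ hj
        simp [Pi.single_eq_of_ne hj]
      · simp
    rw [hv, hv]
    intro h
    have hd : ((y i : ℂ) - z i) ≠ 0 := by exact_mod_cast sub_ne_zero.2 hi
    have h1 : exp (I * ((Real.pi / (y i - z i) : ℝ) : ℂ) * y i) =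
        exp (Real.pi * I) * exp (I * ((Real.pi / (y i - z i) : ℝ) : ℂ) * z i) := by
      rw [← exp_add]
      congr 1
      push_cast
      field_simp
      ring
    rw [exp_pi_mul_I] at h1
    rw [show exp (I * ((Real.pi / (y i - z i) : ℝ) : ℂ) * y i) =
      exp (I * ((Real.pi / (y i - z i) : ℝ) : ℂ) * z i) from h] at h1
    have h2 := exp_ne_zero (I * ((Real.pi / (y i - z i) : ℝ) : ℂ) * z i)
    apply h2
    linear_combination h1 / 2
  · obtain ⟨i, hi⟩ := Function.ne_iff.1 hst
    refine ⟨Pi.single i 1, 0, ?_⟩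
    simp only [torusChar_apply, Pi.zero_apply, ofReal_zero, mul_zero, zero_mul, exp_zero,
      Finset.prod_const_one, mul_one, UnitAddTorus.mFourier_single, fourier_one]
    intro h
    exact hi (AddCircle.injective_toCircle one_ne_zero (Subtype.coe_injective h))

/-- Uniqueness of Fourier coefficients on `(ℝ/ℤ)^r × ℝ^m`. -/
theorem ae_eq_zero_of_forall_integral_torusChar {r m : ℕ}
    {σ : Measure (UnitAddTorus (Fin r) × (Fin m → ℝ))}
    {F : UnitAddTorus (Fin r) × (Fin m → ℝ) → ℂ} (hF : Integrable F σ)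
    (h : ∀ n ξ, ∫ p, torusChar n ξ p * F p ∂σ = 0) : F =ᵐ[σ] 0 := by
  refine ae_eq_zero_of_forall_integral_mul_eq_zero hF (torusCharAlgebra_separatesPoints r m)
    fun g hg => ?_
  have hint : ∀ g : (UnitAddTorus (Fin r) × (Fin m → ℝ)) →ᵇ ℂ,
      Integrable (fun x => g x * F x) σ := fun g =>
    hF.bdd_mul (c := ‖g‖) g.continuous.aestronglyMeasurable
      (Filter.Eventually.of_forall fun x => g.norm_coe_le_norm x)
  have hspan : g ∈ Submodule.span ℂ (Set.range fun q : (Fin r → ℤ) × (Fin m → ℝ) =>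
      (torusChar q.1 q.2 : (UnitAddTorus (Fin r) × (Fin m → ℝ)) →ᵇ ℂ)) := by
    rw [← Algebra.adjoin_eq_span_of_subset]
    · exact hg
    · refine .trans (fun x ↦ Submonoid.closure_induction (fun _ ↦ id) ⟨0, torusChar_zero⟩ ?_)
        Submodule.subset_span
      rintro _ _ _ _ ⟨q, rfl⟩ ⟨q', rfl⟩
      exact ⟨q + q', (torusChar_mul _ _ _ _).symm⟩
  clear hg
  induction hspan using Submodule.span_induction with
  | mem g hg =>
    obtain ⟨q, rfl⟩ := hg
    exact h q.1 q.2
  | zero => simp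
  | add f g hf' hg' hf hg =>
    simp only [BoundedContinuousFunction.add_apply, add_mul]
    rw [integral_add (hint f) (hint g), hf, hg, add_zero]
  | smul c f hf' hf =>
    simp only [BoundedContinuousFunction.smul_apply, smul_eq_mul, mul_assoc]
    rw [integral_const_mul, hf, mul_zero]

/-! ### The orthogonal system of Fourier-Hermite functions -/

/-- The function `(t, y) ↦ exp (2πi ⟨n, t⟩) ∏ H_{k_i}(√ν y_i) exp(-ν y_i² / 2)` on
`(ℝ/ℤ)^r × ℝ^m`. -/
noncomputable def fourierHermite {r m : ℕ} (ν : ℝ) (n : Fin r → ℤ) (k : Fin m → ℕ)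
    (p : UnitAddTorus (Fin r) × (Fin m → ℝ)) : ℂ :=
  UnitAddTorus.mFourier n p.1 * ∏ i, (hermiteFun ν (k i) (p.2 i) : ℂ)

/-- The product of a continuous function on the torus and of square integrable functions of the single
coordinates of `ℝ^m` is square integrable on `(ℝ/ℤ)^r × ℝ^m`. -/
theorem memLp_two_prod {r m : ℕ} (a : C(UnitAddTorus (Fin r), ℂ)) (b : Fin m → ℝ → ℝ)
    (hbc : ∀ i, Continuous (b i)) (hb : ∀ i, Integrable fun t => b i t * b i t) :
    MemLp (fun p : UnitAddTorus (Fin r) × (Fin m → ℝ) => a p.1 * ∏ i, (b i (p.2 i) : ℂ)) 2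
      ((torusMeasure r).prod volume) := by
  have hc : Continuous fun p : UnitAddTorus (Fin r) × (Fin m → ℝ) =>
      a p.1 * ∏ i, (b i (p.2 i) : ℂ) := by fun_prop
  rw [memLp_two_iff_integrable_sq_norm hc.aestronglyMeasurable]
  have h1 : Integrable (fun y : Fin m → ℝ => ∏ i, (b i (y i) * b i (y i))) volume :=
    Integrable.fintype_prod (f := fun i t => b i t * b i t) hb
  have h2 : Integrable (fun t => ‖a t‖ ^ 2) (torusMeasure r) := by
    refine Integrable.of_bound (by fun_prop) (‖a‖ ^ 2) (Filter.Eventually.of_forall fun t => ?_)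
    rw [Real.norm_eq_abs, abs_of_nonneg (by positivity)]
    exact pow_le_pow_left₀ (norm_nonneg _) (a.norm_coe_le_norm t) 2
  refine (h2.mul_prod h1).congr (Filter.Eventually.of_forall fun p => ?_)
  simp only [norm_mul, norm_prod, norm_real, mul_pow, ← Finset.prod_pow, Real.norm_eq_abs, sq_abs]
  simp only [sq]

theorem memLp_fourierHermite {r m : ℕ} {ν : ℝ} (hν : ∀ _ : Fin m, 0 < ν) (n : Fin r → ℤ)
    (k : Fin m → ℕ) : MemLp (fourierHermite ν n k) 2 ((torusMeasure r).prod volume) :=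
  memLp_two_prod _ _ (fun i => continuous_hermiteFun ν (k i))
    (fun i => integrable_hermiteFun_mul (hν i) _ _)

theorem integral_conj_mFourier_mul {r : ℕ} (n n' : Fin r → ℤ) :
    ∫ t, conj (UnitAddTorus.mFourier n t) * UnitAddTorus.mFourier n' t ∂torusMeasure r =
      if n = n' then 1 else 0 := by
  simp only [← UnitAddTorus.mFourier_neg, ← UnitAddTorus.mFourier_add]
  split_ifs with h
  · simp [h, UnitAddTorus.mFourier_zero]
  · rw [UnitAddTorus.mFourier, ContinuousMap.coe_mk, integral_fintype_prod_eq_prod]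
    obtain ⟨i, hi⟩ := Function.ne_iff.1 h
    refine Finset.prod_eq_zero (Finset.mem_univ i) ?_
    have h1 := congrFun (fourierCoeff_fourier (T := 1) (n' i)) (n i)
    rw [Pi.single_eq_of_ne hi] at h1
    simpa only [fourierCoeff, smul_eq_mul, ← fourier_add, Pi.add_apply, Pi.neg_apply] using! h1

theorem integral_conj_fourierHermite_mul {r m : ℕ} (ν : ℝ) (n n' : Fin r → ℤ) (k k' : Fin m → ℕ) :
    ∫ p, conj (fourierHermite ν n k p) * fourierHermite ν n' k' p ∂(torusMeasure r).prod volume =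
      (if n = n' then 1 else 0) *
        ∏ i, ((∫ t, hermiteFun ν (k i) t * hermiteFun ν (k' i) t : ℝ) : ℂ) := by
  have h1 : ∀ p : UnitAddTorus (Fin r) × (Fin m → ℝ),
      conj (fourierHermite ν n k p) * fourierHermite ν n' k' p =
      (conj (UnitAddTorus.mFourier n p.1) * UnitAddTorus.mFourier n' p.1) *
        ∏ i, ((hermiteFun ν (k i) (p.2 i) * hermiteFun ν (k' i) (p.2 i) : ℝ) : ℂ) := by
    intro p
    simp only [fourierHermite, map_mul, map_prod, conj_ofReal, ofReal_mul, Finset.prod_mul_distrib]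
    ring
  simp only [h1]
  rw [integral_prod_mul (fun t => conj (UnitAddTorus.mFourier n t) * UnitAddTorus.mFourier n' t)
    (fun y : Fin m → ℝ => ∏ i, ((hermiteFun ν (k i) (y i) * hermiteFun ν (k' i) (y i) : ℝ) : ℂ)),
    integral_conj_mFourier_mul, integral_fintype_prod_volume_eq_prod
      (fun i t => ((hermiteFun ν (k i) t * hermiteFun ν (k' i) t : ℝ) : ℂ))]
  simp only [integral_complex_ofReal]

theorem integral_conj_fourierHermite_mul_of_ne {r m : ℕ} {ν : ℝ} (hν : ∀ _ : Fin m, 0 < ν)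
    {n n' : Fin r → ℤ} {k k' : Fin m → ℕ} (h : (n, k) ≠ (n', k')) :
    ∫ p, conj (fourierHermite ν n k p) * fourierHermite ν n' k' p ∂(torusMeasure r).prod volume
      = 0 := by
  rw [integral_conj_fourierHermite_mul]
  by_cases hn : n = n'
  · have hk : k ≠ k' := fun hk => h (by rw [hn, hk])
    obtain ⟨i, hi⟩ := Function.ne_iff.1 hk
    rw [Finset.prod_eq_zero (Finset.mem_univ i), mul_zero]
    rw [integral_hermiteFun_mul (hν i), if_neg hi, ofReal_zero]
  · rw [if_neg hn, zero_mul]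

theorem integral_conj_fourierHermite_mul_self {r m : ℕ} {ν : ℝ} (hν : ∀ _ : Fin m, 0 < ν)
    (n : Fin r → ℤ) (k : Fin m → ℕ) :
    ∫ p, conj (fourierHermite ν n k p) * fourierHermite ν n k p ∂(torusMeasure r).prod volume =
      (((Real.pi / ν) ^ ((m : ℝ) / 2) * 2 ^ (∑ i, k i) * ∏ i, ((k i).factorial : ℝ) : ℝ) : ℂ) := by
  rw [integral_conj_fourierHermite_mul, if_pos rfl, one_mul, ← ofReal_prod]
  congr 1
  have h1 : ∀ i, (∫ t, hermiteFun ν (k i) t * hermiteFun ν (k i) t) =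
      (Real.pi / ν) ^ ((1 : ℝ) / 2) * 2 ^ k i * ((k i).factorial : ℝ) := fun i => by
    rw [integral_hermiteFun_mul (hν i), if_pos rfl]
  simp only [h1, Finset.prod_mul_distrib, Finset.prod_const, Finset.card_univ, Fintype.card_fin,
    Finset.prod_pow_eq_pow_sum]
  congr 2
  cases m with
  | zero => simp
  | succ m =>
    rw [← Real.rpow_natCast, ← Real.rpow_mul (div_pos Real.pi_pos (hν 0)).le]
    congr 1
    ring

theorem integrable_exp_abs_sub_sq {ν : ℝ} (hν : 0 < ν) (ξ : ℝ) :
    Integrable fun t : ℝ => Real.exp (|ξ| * |t| - ν * t ^ 2) := by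
  have h1 : ∀ a : ℝ, Integrable fun t : ℝ => Real.exp (a * t - ν * t ^ 2) := by
    intro a
    have := (integrable_cexp_quadratic (b := (ν : ℂ)) (by simpa using hν) a 0).norm
    refine this.congr (Filter.Eventually.of_forall fun t => ?_)
    simp only [norm_exp]
    congr 1
    simp [← ofReal_pow]
    ring
  refine ((h1 |ξ|).add (h1 (-|ξ|))).mono' (by fun_prop) (Filter.Eventually.of_forall fun t => ?_)
  rw [Real.norm_eq_abs, abs_of_pos (Real.exp_pos _), Pi.add_apply]
  rcases le_total 0 t with h | h
  · rw [abs_of_nonneg h]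
    linarith [Real.exp_pos (-|ξ| * t - ν * t ^ 2)]
  · rw [abs_of_nonpos h, mul_neg, ← neg_mul]
    linarith [Real.exp_pos (|ξ| * t - ν * t ^ 2)]

theorem norm_partialSum_exp_le (z : ℂ) (N : ℕ) :
    ‖∑ n ∈ Finset.range N, z ^ n / (n.factorial : ℂ)‖ ≤ Real.exp ‖z‖ := by
  refine (norm_sum_le _ _).trans ?_
  simp only [norm_div, norm_pow, norm_natCast]
  exact Real.sum_le_exp_of_nonneg (norm_nonneg z) N

open Filter Topology in
/-- If `h` is orthogonal to the functions `fourierHermite ν n k`, then the Gaussian-weighted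
function `h(t, y) exp(-ν |y|² / 2)` has vanishing Fourier transform: the power series of
`exp (i ξ_j y_j)` may be integrated term by term. -/
theorem integral_torusChar_mul_gaussian_mul_eq_zero {r m : ℕ} {ν : ℝ} (hν : ∀ _ : Fin m, 0 < ν)
    {h : UnitAddTorus (Fin r) × (Fin m → ℝ) → ℂ}
    (hh : MemLp h 2 ((torusMeasure r).prod volume))
    (horth : ∀ n k, ∫ p, fourierHermite ν n k p * h p ∂(torusMeasure r).prod volume = 0)
    (n : Fin r → ℤ) (ξ : Fin m → ℝ) :
    ∫ p, torusChar n ξ p * ((∏ i, (Real.exp (-(ν / 2) * p.2 i ^ 2) : ℂ)) * h p)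
      ∂(torusMeasure r).prod volume = 0 := by
  set S : ℕ → ℂ → ℂ := fun N z => ∑ j ∈ Finset.range N, z ^ j / (j.factorial : ℂ) with hS
  have hSc : ∀ N, Continuous (S N) := fun N => by simp only [hS]; fun_prop
  set A : ℕ → UnitAddTorus (Fin r) × (Fin m → ℝ) → ℂ := fun N p =>
    (UnitAddTorus.mFourier n p.1 *
      ∏ i, (S N (I * ξ i * p.2 i) * (Real.exp (-(ν / 2) * p.2 i ^ 2) : ℂ))) * h p with hA
  have hA0 : ∀ N, ∫ p, A N p ∂(torusMeasure r).prod volume = 0 := by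
    intro N
    choose c hc using fun i => exists_partialSum_exp_eq (hν i) (I * ξ i) N
    have h1 : ∀ p, A N p = ∑ k ∈ Fintype.piFinset fun i => (c i).support,
        (∏ i, c i (k i)) * (fourierHermite ν n k p * h p) := by
      intro p
      simp only [hA, hS, hc]
      simp only [Finset.sum_mul]
      rw [Finset.prod_univ_sum, Finset.mul_sum, Finset.sum_mul]
      refine Finset.sum_congr rfl fun k _ => ?_
      simp only [fourierHermite, hermiteFun, ofReal_mul, Finset.prod_mul_distrib]
      ring
    simp only [h1]
    rw [integral_finsetSum]
    · refine Finset.sum_eq_zero fun k _ => ?_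
      rw [integral_const_mul, horth, mul_zero]
    · intro k _
      exact ((memLp_fourierHermite hν n k).integrable_mul hh).const_mul _
  have hlim : Tendsto (fun N => ∫ p, A N p ∂(torusMeasure r).prod volume) atTop
      (𝓝 (∫ p, torusChar n ξ p * ((∏ i, (Real.exp (-(ν / 2) * p.2 i ^ 2) : ℂ)) * h p)
        ∂(torusMeasure r).prod volume)) := by
    have hb : MemLp (fun p : UnitAddTorus (Fin r) × (Fin m → ℝ) =>
        (1 : C(UnitAddTorus (Fin r), ℂ)) p.1 *
          ∏ i, ((Real.exp (|ξ i| * |p.2 i| + -(ν / 2) * p.2 i ^ 2) : ℝ) : ℂ)) 2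
        ((torusMeasure r).prod volume) := by
      refine memLp_two_prod 1 (fun i t => Real.exp (|ξ i| * |t| + -(ν / 2) * t ^ 2))
        (fun i => by fun_prop) fun i => ?_
      refine (integrable_exp_abs_sub_sq (hν i) (2 * ξ i)).congr (Eventually.of_forall fun t => ?_)
      simp only
      rw [← Real.exp_add, abs_mul, abs_two]
      congr 1
      ring
    refine tendsto_integral_of_dominated_convergence _ (fun N => ?_)
      (hb.integrable_mul hh).norm (fun N => ?_) ?_
    · refine AEStronglyMeasurable.mul (Continuous.aestronglyMeasurable ?_) hh.1
      have := hSc N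
      fun_prop
    · refine Eventually.of_forall fun p => ?_
      simp only [hA, Pi.mul_apply, norm_mul]
      refine mul_le_mul_of_nonneg_right ?_ (norm_nonneg _)
      have h1 : ‖UnitAddTorus.mFourier n p.1‖ ≤ 1 :=
        ((UnitAddTorus.mFourier n).norm_coe_le_norm p.1).trans UnitAddTorus.mFourier_norm.le
      simp only [ContinuousMap.one_apply, norm_one, norm_prod, norm_mul, norm_real,
        Real.norm_eq_abs, Real.abs_exp]
      refine mul_le_mul h1 (Finset.prod_le_prod (fun i _ => by positivity) fun i _ => ?_)
        (by positivity) zero_le_one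
      rw [Real.exp_add]
      refine mul_le_mul_of_nonneg_right ?_ (Real.exp_pos _).le
      refine (norm_partialSum_exp_le _ _).trans (le_of_eq ?_)
      simp
    · refine Eventually.of_forall fun p => ?_
      have h1 : ∀ z : ℂ, Tendsto (fun N => S N z) atTop (𝓝 (exp z)) := by
        intro z
        rw [exp_eq_exp_ℂ]
        exact (NormedSpace.expSeries_div_hasSum_exp z).tendsto_sum_nat
      have h2 : torusChar n ξ p * ((∏ i, (Real.exp (-(ν / 2) * p.2 i ^ 2) : ℂ)) * h p) =
          (UnitAddTorus.mFourier n p.1 *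
      ∏ i, (exp (I * ξ i * p.2 i) * (Real.exp (-(ν / 2) * p.2 i ^ 2) : ℂ))) * h p := by
        rw [torusChar_apply, Finset.prod_mul_distrib]
        ring
      rw [h2]
      exact ((tendsto_finsetProd _ fun i _ => (h1 _).mul_const _).const_mul _).mul_const _
  exact tendsto_nhds_unique hlim (by simp only [hA0]; exact tendsto_const_nhds)

/-- The functions `fourierHermite ν n k` are total in `L²((ℝ/ℤ)^r × ℝ^m)`. -/
theorem ae_eq_zero_of_forall_integral_conj_fourierHermite {r m : ℕ} {ν : ℝ}
    (hν : ∀ _ : Fin m, 0 < ν) {h : UnitAddTorus (Fin r) × (Fin m → ℝ) → ℂ}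
    (hh : MemLp h 2 ((torusMeasure r).prod volume))
    (horth : ∀ n k, ∫ p, conj (fourierHermite ν n k p) * h p ∂(torusMeasure r).prod volume = 0) :
    h =ᵐ[(torusMeasure r).prod volume] 0 := by
  have horth' : ∀ n k, ∫ p, fourierHermite ν n k p * h p ∂(torusMeasure r).prod volume = 0 := by
    intro n k
    rw [← horth (-n) k]
    refine integral_congr_ae (Filter.Eventually.of_forall fun p => ?_)
    simp only [fourierHermite, map_mul, map_prod, conj_ofReal, ← UnitAddTorus.mFourier_neg,
      neg_neg]
  have hint : Integrable (fun p => (∏ i, (Real.exp (-(ν / 2) * p.2 i ^ 2) : ℂ)) * h p)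
      ((torusMeasure r).prod volume) := by
    have hm : fourierHermite (r := r) (m := m) ν 0 0 =
        fun p => ∏ i, (Real.exp (-(ν / 2) * p.2 i ^ 2) : ℂ) := by
      funext p
      simp [fourierHermite, hermiteFun, hermitePoly, UnitAddTorus.mFourier_zero]
    have := (memLp_fourierHermite hν (0 : Fin r → ℤ) (0 : Fin m → ℕ)).integrable_mul hh
    rw [hm] at this
    exact this
  filter_upwards [ae_eq_zero_of_forall_integral_torusChar hint
    (integral_torusChar_mul_gaussian_mul_eq_zero hν hh horth')] with p hp
  refine (mul_eq_zero.1 hp).resolve_left (Finset.prod_ne_zero_iff.2 fun i _ => ?_)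
  exact_mod_cast (Real.exp_pos _).ne'

/-! ### The quotient of the Euclidean space by a discrete subgroup -/

section Lattice

variable {d r : ℕ} (Γ : AddSubgroup (EuclideanSpace ℝ (Fin d)))

/-- A discrete subgroup of rank `r` is, in suitable coordinates of its real span, the lattice of
integral points of `ℝ^r`. -/
theorem exists_basis_mem_iff [DiscreteTopology Γ] (hr : Module.finrank ℤ Γ = r) :
    ∃ b : Module.Basis (Fin r) ℝ (realSpan Γ), ∀ x : realSpan Γ,
      (x : EuclideanSpace ℝ (Fin d)) ∈ Γ ↔ ∀ i, ∃ n : ℤ, b.repr x i = n := by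
  set L : Submodule ℤ (realSpan Γ) := AddSubgroup.toIntSubmodule (latticeInSpan Γ) with hL
  have hmem : ∀ x : realSpan Γ, x ∈ L ↔ (x : EuclideanSpace ℝ (Fin d)) ∈ Γ := fun _ => Iff.rfl
  let e : L ≃+ Γ :=
    { toFun := fun x => ⟨x.1.1, (hmem _).1 x.2⟩
      invFun := fun g => ⟨⟨g.1, Submodule.subset_span g.2⟩, g.2⟩
      left_inv := fun _ => rfl
      right_inv := fun _ => rfl
      map_add' := fun _ _ => rfl }
  have hdisc : DiscreteTopology L := by
    refine DiscreteTopology.of_continuous_injective (f := e) ?_ e.injective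
    exact Continuous.subtype_mk (continuous_subtype_val.comp continuous_subtype_val) _
  have hlat : IsZLattice ℝ L := ⟨eq_top_iff.mpr <|
    Submodule.span_span_coe_preimage.symm.le.trans (Submodule.span_mono fun _ h => h)⟩
  have hfree : Module.Free ℤ L := ZLattice.module_free ℝ L
  have hfin : Module.Finite ℤ L := ZLattice.module_finite ℝ L
  have hrank : Module.finrank ℤ L = r := by rw [← hr]; exact e.toIntLinearEquiv.finrank_eq
  let b₀ : Module.Basis (Fin r) ℤ L := Module.finBasisOfFinrankEq ℤ L hrank
  refine ⟨b₀.ofZLatticeBasis ℝ L, fun x => ?_⟩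
  rw [← hmem]
  constructor
  · intro hx i
    exact ⟨b₀.repr ⟨x, hx⟩ i, b₀.ofZLatticeBasis_repr_apply ℝ L ⟨x, hx⟩ i⟩
  · intro hx
    choose n hn using hx
    rw [← (b₀.ofZLatticeBasis ℝ L).sum_repr x]
    refine Submodule.sum_mem _ fun i _ => ?_
    rw [hn, b₀.ofZLatticeBasis_apply ℝ L, Int.cast_smul_eq_zsmul]
    exact Submodule.smul_mem _ _ (b₀ i).2

theorem countable_of_discrete [DiscreteTopology Γ] : Countable Γ :=
  TopologicalSpace.separableSpace_iff_countable.mp inferInstance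

variable {Γ}
variable {m : ℕ} (b : Module.Basis (Fin r) ℝ (realSpan Γ))
  (w : OrthonormalBasis (Fin m) ℝ (realSpan Γ)ᗮ)

/-- The quotient map `V_Γ → (ℝ/ℤ)^r` sending a vector to its coordinates modulo `1`. -/
noncomputable def toTorus (x : realSpan Γ) : UnitAddTorus (Fin r) := fun i => (b.repr x i : ℝ)

theorem continuous_toTorus : Continuous (toTorus b) := by
  refine continuous_pi fun i => (AddCircle.continuous_mk' 1).comp ?_
  exact (b.coord i).continuous_of_finiteDimensional

theorem toTorus_add (x y : realSpan Γ) : toTorus b (x + y) = toTorus b x + toTorus b y := by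
  funext i
  simp [toTorus]

theorem toTorus_surjective : Function.Surjective (toTorus b) := by
  intro t
  choose c hc using fun i => QuotientAddGroup.mk_surjective (t i)
  refine ⟨b.equivFun.symm c, funext fun i => ?_⟩
  rw [← hc i, toTorus, ← Module.Basis.equivFun_apply, LinearEquiv.apply_symm_apply]

variable (hb : ∀ x : realSpan Γ, (x : EuclideanSpace ℝ (Fin d)) ∈ Γ ↔ ∀ i, ∃ n : ℤ, b.repr x i = n)

include hb in
theorem toTorus_eq_zero {x : realSpan Γ} (hx : (x : EuclideanSpace ℝ (Fin d)) ∈ Γ) :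
    toTorus b x = 0 := by
  funext i
  obtain ⟨n, hn⟩ := (hb x).1 hx i
  rw [toTorus, hn, Pi.zero_apply]
  exact (AddCircle.coe_eq_zero_iff 1).2 ⟨n, by simp⟩

instance countable_latticeInSpan [Countable Γ] : Countable (latticeInSpan Γ) := by
  refine Function.Injective.countable (f := fun x : latticeInSpan Γ => (⟨x.1.1, x.2⟩ : Γ)) ?_
  intro x y h
  exact Subtype.ext (Subtype.ext (congrArg (fun g : Γ => g.1) h))

include hb in
theorem isAddFundamentalDomain_zspan : IsAddFundamentalDomain (latticeInSpan Γ)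
    (ZSpan.fundamentalDomain b) volume := by
  have h : latticeInSpan Γ = (Submodule.span ℤ (Set.range b)).toAddSubgroup := by
    ext x
    rw [Submodule.mem_toAddSubgroup, b.mem_span_iff_repr_mem ℤ]
    change (x : EuclideanSpace ℝ (Fin d)) ∈ Γ ↔ _
    rw [hb]
    simp [eq_comm]
  rw [h]
  exact ZSpan.isAddFundamentalDomain' b volume

include hb in
theorem volume_fundamentalDomain_ne_top [Countable Γ] {Λ₁ : Set (realSpan Γ)}
    (hΛ₁ : IsAddFundamentalDomain (latticeInSpan Γ) Λ₁ volume) : volume Λ₁ ≠ ⊤ := by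
  rw [hΛ₁.measure_eq (isAddFundamentalDomain_zspan b hb)]
  exact (ZSpan.fundamentalDomain_isBounded b).measure_lt_top.ne

open scoped Pointwise in
include hb in
/-- The image of Lebesgue measure on a fundamental domain is a multiple of the Haar measure of the
torus: it is translation invariant, since a translate of a fundamental domain is another one. -/
theorem map_toTorus_restrict [Countable Γ] {Λ₁ : Set (realSpan Γ)}
    (hΛ₁ : IsAddFundamentalDomain (latticeInSpan Γ) Λ₁ volume) :
    (volume.restrict Λ₁).map (toTorus b) = volume Λ₁ • torusMeasure r := by
  have hq : Measurable (toTorus b) := (continuous_toTorus b).measurable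
  have hfin : IsFiniteMeasure (volume.restrict Λ₁) :=
    isFiniteMeasure_restrict.2 (volume_fundamentalDomain_ne_top b hb hΛ₁)
  have hinv : ((volume.restrict Λ₁).map (toTorus b)).IsAddLeftInvariant := by
    refine ⟨fun t => ?_⟩
    obtain ⟨a, rfl⟩ := toTorus_surjective b t
    ext s hs
    have hA : MeasurableSet (toTorus b ⁻¹' s) := hq hs
    rw [Measure.map_apply (measurable_const_add _) hs,
      Measure.map_apply hq (measurable_const_add _ hs), Measure.map_apply hq hs,
      Measure.restrict_apply hA, Measure.restrict_apply (hq (measurable_const_add _ hs)),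
      hΛ₁.measure_set_eq (hΛ₁.vadd_of_comm a) hA]
    · rw [← measure_preimage_add volume a (toTorus b ⁻¹' s ∩ (a +ᵥ Λ₁))]
      congr 1
      ext x
      simp only [Set.mem_inter_iff, Set.mem_preimage, toTorus_add]
      refine and_congr_right fun _ => ?_
      exact (Set.vadd_mem_vadd_set_iff (a := a)).symm
    · intro g
      ext x
      change toTorus b (g.1 + x) ∈ s ↔ toTorus b x ∈ s
      rw [toTorus_add, toTorus_eq_zero b hb g.2, zero_add]
  have h := Measure.isAddInvariant_eq_smul_of_compactSpace
    ((volume.restrict Λ₁).map (toTorus b)) (torusMeasure r)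
  have h2 := congrArg (fun μ => μ Set.univ) h
  simp only [Measure.map_apply hq MeasurableSet.univ, Set.preimage_univ, Measure.restrict_apply_univ,
    Measure.smul_apply, measure_univ, ENNReal.smul_def, smul_eq_mul, mul_one] at h2
  rw [h, h2]
  rfl

/-- The quotient map `ℝ^d → ℝ^d / Γ ≅ (ℝ/ℤ)^r × ℝ^m` given by the coordinates modulo `1` of `x₁`
in a basis of `Γ` and the coordinates of `x₂` in the orthonormal basis `w`. -/
noncomputable def quotientMap (x : EuclideanSpace ℝ (Fin d)) :
    UnitAddTorus (Fin r) × (Fin m → ℝ) :=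
  (toTorus b ((realSpan Γ).orthogonalProjectionOnto x),
    fun j => w.repr ((realSpan Γ)ᗮ.orthogonalProjectionOnto x) j)

theorem continuous_quotientMap : Continuous (quotientMap b w) := by
  refine ((continuous_toTorus b).comp (ContinuousLinearMap.continuous _)).prodMk ?_
  refine continuous_pi fun j => ?_
  fun_prop

include hb in
theorem quotientMap_add (x : EuclideanSpace ℝ (Fin d)) {γ : EuclideanSpace ℝ (Fin d)}
    (hγ : γ ∈ Γ) : quotientMap b w (x + γ) = quotientMap b w x := by
  have hγV : γ ∈ realSpan Γ := Submodule.subset_span hγ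
  have h1 : (realSpan Γ)ᗮ.orthogonalProjectionOnto γ = 0 :=
    Submodule.orthogonalProjectionOnto_eq_zero_iff.2
      ((realSpan Γ).le_orthogonal_orthogonal hγV)
  have h2 : (realSpan Γ).orthogonalProjectionOnto γ = ⟨γ, hγV⟩ :=
    Submodule.orthogonalProjectionOnto_mem_subspace_eq_self (K := realSpan Γ) ⟨γ, hγV⟩
  simp only [quotientMap, map_add, h1, h2, add_zero, toTorus_add]
  rw [toTorus_eq_zero b hb (x := ⟨γ, hγV⟩) hγ, add_zero]

/-- The orthogonal decomposition `x ↦ (x₁, x₂)`, as a measurable equivalence with the plain product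
(not the `L²` product) of `V` and its orthogonal complement. -/
noncomputable def splitEquiv (V : Submodule ℝ (EuclideanSpace ℝ (Fin d))) :
    EuclideanSpace ℝ (Fin d) ≃ᵐ V × Vᗮ :=
  V.orthogonalDecomposition.toHomeomorph.toMeasurableEquiv.trans (MeasurableEquiv.toLp 2 _).symm

theorem splitEquiv_apply (V : Submodule ℝ (EuclideanSpace ℝ (Fin d)))
    (x : EuclideanSpace ℝ (Fin d)) :
    splitEquiv V x = (V.orthogonalProjectionOnto x, Vᗮ.orthogonalProjectionOnto x) := by
  simp [splitEquiv]

theorem measurePreserving_splitEquiv (V : Submodule ℝ (EuclideanSpace ℝ (Fin d))) :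
    MeasurePreserving (splitEquiv V) volume (volume.prod volume) :=
  V.orthogonalDecomposition.measurePreserving.trans (WithLp.volume_preserving_ofLp _ _)

theorem isAddFundamentalDomain_preimage_proj {Λ₁ : Set (realSpan Γ)}
    (hΛ₁ : IsAddFundamentalDomain (latticeInSpan Γ) Λ₁ volume) :
    IsAddFundamentalDomain Γ ((realSpan Γ).orthogonalProjectionOnto ⁻¹' Λ₁) volume := by
  refine hΛ₁.preimage_of_equiv
    (e := fun g : latticeInSpan Γ => (⟨g.1.1, g.2⟩ : Γ)) ?_ ⟨?_, ?_⟩ ?_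
  · have h := Measure.quasiMeasurePreserving_fst.comp
      (measurePreserving_splitEquiv (realSpan Γ)).quasiMeasurePreserving
    convert! h using 1
  · intro x y h
    exact Subtype.ext (Subtype.ext (congrArg (fun g : Γ => g.1) h))
  · intro g
    exact ⟨⟨⟨g.1, Submodule.subset_span g.2⟩, g.2⟩, rfl⟩
  · intro g x
    change (realSpan Γ).orthogonalProjectionOnto (g.1.1 + x) =
      g.1 + (realSpan Γ).orthogonalProjectionOnto x
    rw [map_add, Submodule.orthogonalProjectionOnto_mem_subspace_eq_self]

include hb in
/-- The image of Lebesgue measure on a fundamental domain of `Γ` in `ℝ^d` under the quotient map is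
`vol(Λ₁)` times the product of the Haar and Lebesgue measures. -/
theorem map_quotientMap_restrict [Countable Γ] {Λ₁ : Set (realSpan Γ)}
    (hΛ₁ : IsAddFundamentalDomain (latticeInSpan Γ) Λ₁ volume)
    {Λ : Set (EuclideanSpace ℝ (Fin d))} (hΛ : IsAddFundamentalDomain Γ Λ volume) :
    (volume.restrict Λ).map (quotientMap b w) =
      volume Λ₁ • (torusMeasure r).prod (volume : Measure (Fin m → ℝ)) := by
  have hq : Measurable (quotientMap b w) := (continuous_quotientMap b w).measurable
  have h1 : (volume.restrict Λ).map (quotientMap b w) = (volume.restrict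
      ((realSpan Γ).orthogonalProjectionOnto ⁻¹' Λ₁)).map (quotientMap b w) := by
    ext s hs
    rw [Measure.map_apply hq hs, Measure.map_apply hq hs, Measure.restrict_apply (hq hs),
      Measure.restrict_apply (hq hs)]
    refine hΛ.measure_set_eq (isAddFundamentalDomain_preimage_proj hΛ₁) (hq hs) fun g => ?_
    ext x
    change quotientMap b w (g.1 + x) ∈ s ↔ quotientMap b w x ∈ s
    rw [add_comm, quotientMap_add b w hb x g.2]
  set D := splitEquiv (realSpan Γ) with hD
  have h2 : (realSpan Γ).orthogonalProjectionOnto ⁻¹' Λ₁ = D ⁻¹' (Λ₁ ×ˢ Set.univ) := by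
    ext x
    simp [hD, splitEquiv_apply]
  have hw : MeasurePreserving (fun z : (realSpan Γ)ᗮ => fun j => w.repr z j) volume volume :=
    (PiLp.volume_preserving_ofLp (Fin m)).comp w.repr.measurePreserving
  have h3 : quotientMap b w =
      Prod.map (toTorus b) (fun z : (realSpan Γ)ᗮ => fun j => w.repr z j) ∘ D := by
    funext x
    simp [hD, splitEquiv_apply, quotientMap]
  have h4 := (measurePreserving_splitEquiv (realSpan Γ)).restrict_preimage_emb
    D.measurableEmbedding (Λ₁ ×ˢ Set.univ)
  have hfin : IsFiniteMeasure (volume.restrict Λ₁) :=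
    isFiniteMeasure_restrict.2 (volume_fundamentalDomain_ne_top b hb hΛ₁)
  rw [h1, h2, h3, ← Measure.map_map ((continuous_toTorus b).measurable.prodMap hw.measurable)
    D.measurable, h4.map_eq, ← Measure.prod_restrict, Measure.restrict_univ,
    ← Measure.map_prod_map _ _ (continuous_toTorus b).measurable hw.measurable, hw.map_eq,
    map_toTorus_restrict b hb hΛ₁, Measure.prod_smul_left]

/-- A measurable section of the quotient map: coordinates modulo `1` are lifted to `(0, 1]`. -/
noncomputable def quotientSection (p : UnitAddTorus (Fin r) × (Fin m → ℝ)) :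
    EuclideanSpace ℝ (Fin d) :=
  ((∑ i, (AddCircle.equivIoc (1 : ℝ) 0 (p.1 i) : ℝ) • b i : realSpan Γ) :
      EuclideanSpace ℝ (Fin d)) +
    ((∑ j, p.2 j • w j : (realSpan Γ)ᗮ) : EuclideanSpace ℝ (Fin d))

theorem measurable_quotientSection : Measurable (quotientSection b w) := by
  have h1 : Measurable fun t : UnitAddCircle => (AddCircle.equivIoc (1 : ℝ) 0 t : ℝ) :=
    measurable_subtype_coe.comp (AddCircle.measurableEquivIoc 1 0).measurable
  refine Measurable.add ?_ ?_
  · refine measurable_subtype_coe.comp (Finset.measurable_sum _ fun i _ => ?_)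
    exact (h1.comp ((measurable_pi_apply i).comp measurable_fst)).smul_const _
  · refine measurable_subtype_coe.comp (Finset.measurable_sum _ fun j _ => ?_)
    exact ((measurable_pi_apply j).comp measurable_snd).smul_const _

include hb in
theorem exists_quotientSection_quotientMap (x : EuclideanSpace ℝ (Fin d)) :
    ∃ γ : Γ, quotientSection b w (quotientMap b w x) = x + γ := by
  set x₁ := (realSpan Γ).orthogonalProjectionOnto x
  set x₂ := (realSpan Γ)ᗮ.orthogonalProjectionOnto x
  set u : realSpan Γ := ∑ i, (AddCircle.equivIoc (1 : ℝ) 0 (toTorus b x₁ i) : ℝ) • b i with hu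
  have hmem : ((u - x₁ : realSpan Γ) : EuclideanSpace ℝ (Fin d)) ∈ Γ := by
    rw [hb]
    intro i
    have h1 : ((AddCircle.equivIoc (1 : ℝ) 0 (toTorus b x₁ i) : ℝ) : UnitAddCircle) =
        ((b.repr x₁ i : ℝ) : UnitAddCircle) :=
      (AddCircle.equivIoc (1 : ℝ) 0).symm_apply_apply (toTorus b x₁ i)
    have h2 : b.repr u i = (AddCircle.equivIoc (1 : ℝ) 0 (toTorus b x₁ i) : ℝ) := by
      rw [hu, ← Module.Basis.equivFun_apply, ← Module.Basis.equivFun_symm_apply,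
        LinearEquiv.apply_symm_apply]
    rw [← h2, ← sub_eq_zero, ← AddCircle.coe_sub] at h1
    obtain ⟨n, hn⟩ := (AddCircle.coe_eq_zero_iff 1).1 h1
    refine ⟨n, ?_⟩
    rw [map_sub, Finsupp.sub_apply, ← hn]
    simp
  refine ⟨⟨_, hmem⟩, ?_⟩
  have h3 : (∑ j, (quotientMap b w x).2 j • w j : (realSpan Γ)ᗮ) = x₂ := w.sum_repr x₂
  have h4 : (x₁ : EuclideanSpace ℝ (Fin d)) + x₂ = x :=
    (realSpan Γ).starProjection_add_starProjection_orthogonal x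
  rw [quotientSection, h3]
  change (u : EuclideanSpace ℝ (Fin d)) + x₂ = x + ((u - x₁ : realSpan Γ) : EuclideanSpace ℝ (Fin d))
  rw [Submodule.coe_sub, ← sub_eq_zero, ← h4]
  abel

end Lattice

/-! ### Theta functions as square integrable functions on the quotient -/

section Transfer

variable {d r m : ℕ} {Γ : AddSubgroup (EuclideanSpace ℝ (Fin d))}

/-- The function `x ↦ exp (ν ‖x‖² / 2 + 2πi ⟨v, x⟩)`, whose factor of automorphy under `Γ` is that
of the theta functions and whose modulus is the inverse square root of the Gaussian weight. -/
noncomputable def thetaWeight (ν : ℝ) (v x : EuclideanSpace ℝ (Fin d)) : ℂ :=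
  exp (((ν / 2 * ‖x‖ ^ 2 : ℝ) : ℂ) + 2 * (Real.pi : ℂ) * I * ((inner ℝ v x : ℝ) : ℂ))

theorem continuous_thetaWeight (ν : ℝ) (v : EuclideanSpace ℝ (Fin d)) :
    Continuous (thetaWeight ν v) := by
  unfold thetaWeight
  fun_prop

theorem thetaWeight_ne_zero (ν : ℝ) (v x : EuclideanSpace ℝ (Fin d)) : thetaWeight ν v x ≠ 0 :=
  exp_ne_zero _

theorem norm_thetaWeight_sq_mul_exp (ν : ℝ) (v x : EuclideanSpace ℝ (Fin d)) :
    ‖thetaWeight ν v x‖ ^ 2 * Real.exp (-ν * ‖x‖ ^ 2) = 1 := by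
  have h : 2 * (Real.pi : ℂ) * I * ((inner ℝ v x : ℝ) : ℂ) =
      ((2 * Real.pi * inner ℝ v x : ℝ) : ℂ) * I := by
    push_cast
    ring
  rw [thetaWeight, exp_add, h, norm_mul, norm_exp_ofReal_mul_I, mul_one, ← ofReal_exp, norm_real,
    Real.norm_eq_abs, Real.abs_exp, sq, ← Real.exp_add, ← Real.exp_add, Real.exp_eq_one_iff]
  ring

theorem thetaWeight_add (ν : ℝ) (χ : Γ → Circle) (v : EuclideanSpace ℝ (Fin d))
    (hv : ∀ γ : Γ, (χ γ : ℂ) = exp (2 * (Real.pi : ℂ) * I *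
      ((inner ℝ v (γ : EuclideanSpace ℝ (Fin d)) : ℝ) : ℂ)))
    (γ : Γ) (x : EuclideanSpace ℝ (Fin d)) :
    thetaWeight ν v (x + γ) = autFactor ν Γ χ γ x * thetaWeight ν v x := by
  rw [autFactor, hv, thetaWeight, thetaWeight, ofReal_exp, ← exp_add, ← exp_add]
  congr 1
  have h1 : ‖x + (γ : EuclideanSpace ℝ (Fin d))‖ ^ 2 =
      ‖x‖ ^ 2 + 2 * inner ℝ x (γ : EuclideanSpace ℝ (Fin d)) +
        ‖(γ : EuclideanSpace ℝ (Fin d))‖ ^ 2 := norm_add_sq_real _ _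
  rw [h1, inner_add_right, inner_add_left, real_inner_smul_left, real_inner_self_eq_norm_sq]
  push_cast
  ring

theorem norm_mul_thetaWeight_sq_mul_exp (ν : ℝ) (v x : EuclideanSpace ℝ (Fin d)) (z : ℂ) :
    ‖z * thetaWeight ν v x‖ ^ 2 * Real.exp (-ν * ‖x‖ ^ 2) = ‖z‖ ^ 2 := by
  rw [norm_mul, mul_pow, mul_assoc, norm_thetaWeight_sq_mul_exp, mul_one]

variable (b : Module.Basis (Fin r) ℝ (realSpan Γ)) (w : OrthonormalBasis (Fin m) ℝ (realSpan Γ)ᗮ)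
  (hb : ∀ x : realSpan Γ, (x : EuclideanSpace ℝ (Fin d)) ∈ Γ ↔ ∀ i, ∃ n : ℤ, b.repr x i = n)

include hb in
theorem quasiMeasurePreserving_quotientMap [Countable Γ] {Λ : Set (EuclideanSpace ℝ (Fin d))}
    (hΛ : IsAddFundamentalDomain Γ Λ volume) : Measure.QuasiMeasurePreserving (quotientMap b w)
      volume ((volume.restrict Λ).map (quotientMap b w)) := by
  have hq : Measurable (quotientMap b w) := (continuous_quotientMap b w).measurable
  refine ⟨hq, Measure.AbsolutelyContinuous.mk fun s hs h => ?_⟩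
  rw [Measure.map_apply hq hs, Measure.restrict_apply (hq hs)] at h
  rw [Measure.map_apply hq hs]
  refine hΛ.measure_zero_of_invariant _ (fun g => ?_) h
  ext x
  rw [Set.mem_vadd_set_iff_neg_vadd_mem]
  change quotientMap b w ((-g : Γ).1 + x) ∈ s ↔ quotientMap b w x ∈ s
  rw [add_comm, quotientMap_add b w hb x (-g).2]

theorem Lp_norm_sq_eq_integral {Y : Type*} [MeasurableSpace Y] {ρ : Measure Y} (h : Lp ℂ 2 ρ) :
    ‖h‖ ^ 2 = ∫ y, ‖h y‖ ^ 2 ∂ρ := by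
  rw [← inner_self_eq_norm_sq (𝕜 := ℂ) h, L2.inner_def]
  have : ∀ y, inner ℂ (h y) (h y) = ((‖h y‖ ^ 2 : ℝ) : ℂ) := fun y => by
    rw [inner_self_eq_norm_sq_to_K]
    push_cast
    rfl
  simp only [this]
  rw [integral_complex_ofReal]
  exact ofReal_re _

include hb in
/-- The space of theta functions is `L²` of the quotient `ℝ^d / Γ`: every theta function is
`thetaWeight` times the pullback of a square integrable function on the quotient. -/
theorem exists_linearIsometryEquiv_thetaSpace [DiscreteTopology Γ] (ν : ℝ) (χ : Γ → Circle)
    {v : EuclideanSpace ℝ (Fin d)}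
    (hv : ∀ γ : Γ, (χ γ : ℂ) = exp (2 * (Real.pi : ℂ) * I *
      ((inner ℝ v (γ : EuclideanSpace ℝ (Fin d)) : ℝ) : ℂ)))
    {Λ : Set (EuclideanSpace ℝ (Fin d))} (hΛ : IsAddFundamentalDomain Γ Λ volume) :
    ∃ T : Lp ℂ 2 ((volume.restrict Λ).map (quotientMap b w)) ≃ₗᵢ[ℂ] thetaSpace ν Γ χ hΛ,
      ∀ h, ((T h).1 : EuclideanSpace ℝ (Fin d) → ℂ) =ᵐ[volume]
        fun x => h (quotientMap b w x) * thetaWeight ν v x := by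
  have hcount : Countable Γ := countable_of_discrete Γ
  set ρ := (volume.restrict Λ).map (quotientMap b w) with hρ
  have hq := quasiMeasurePreserving_quotientMap b w hb hΛ
  have hqm : Measurable (quotientMap b w) := hq.measurable
  have hmp : MeasurePreserving (quotientMap b w) (volume.restrict Λ) ρ := ⟨hqm, rfl⟩
  -- the pullback of a function on the quotient, as a class of functions on `ℝ^d`
  let P : Lp ℂ 2 ρ → (EuclideanSpace ℝ (Fin d) →ₘ[volume] ℂ) := fun h =>
    AEEqFun.mk (fun x => h (quotientMap b w x) * thetaWeight ν v x)
      (((Lp.aestronglyMeasurable h).comp_quasiMeasurePreserving hq).mul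
        (continuous_thetaWeight ν v).aestronglyMeasurable)
  have hP : ∀ h, P h =ᵐ[volume] fun x => h (quotientMap b w x) * thetaWeight ν v x :=
    fun h => AEEqFun.coeFn_mk _ _
  have hPn : ∀ h, ∀ᵐ x ∂volume.restrict Λ,
      ‖P h x‖ ^ 2 * Real.exp (-ν * ‖x‖ ^ 2) = ‖h (quotientMap b w x)‖ ^ 2 := by
    intro h
    filter_upwards [ae_restrict_of_ae (hP h)] with x hx
    rw [hx, norm_mul_thetaWeight_sq_mul_exp]
  have hsq : ∀ h : Lp ℂ 2 ρ, Integrable (fun y => ‖h y‖ ^ 2) ρ := fun h =>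
    (memLp_two_iff_integrable_sq_norm (Lp.aestronglyMeasurable h)).1 (Lp.memLp h)
  have hmem : ∀ h, P h ∈ thetaSpace ν Γ χ hΛ := by
    intro h
    refine ⟨fun γ => ?_, ?_⟩
    · filter_upwards [hP h, ae_shift (hP h) (γ : EuclideanSpace ℝ (Fin d))] with x h1 h2
      rw [h1, h2, quotientMap_add b w hb x γ.2, thetaWeight_add ν χ v hv]
      ring
    · refine Integrable.congr ?_ ((hPn h).mono fun x hx => hx.symm)
      exact hmp.integrable_comp_of_integrable (hsq h)
  let T₀ : Lp ℂ 2 ρ →ₗ[ℂ] thetaSpace ν Γ χ hΛ :=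
    { toFun := fun h => ⟨P h, hmem h⟩
      map_add' := fun f g => by
        refine Subtype.ext (AEEqFun.ext ?_)
        filter_upwards [hP (f + g), hP f, hP g, AEEqFun.coeFn_add (P f) (P g),
          hq.ae (Lp.coeFn_add f g)] with x h1 h2 h3 h4 h5
        rw [h1, Submodule.coe_add, h4, Pi.add_apply, h2, h3, h5, Pi.add_apply, add_mul]
      map_smul' := fun c f => by
        refine Subtype.ext (AEEqFun.ext ?_)
        filter_upwards [hP (c • f), hP f, AEEqFun.coeFn_smul c (P f),
          hq.ae (Lp.coeFn_smul c f)] with x h1 h2 h3 h4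
        rw [h1, RingHom.id_apply, Submodule.coe_smul, h3, Pi.smul_apply, h2, h4, Pi.smul_apply,
          smul_eq_mul, smul_eq_mul, mul_assoc] }
  have hnorm : ∀ h, ‖T₀ h‖ = ‖h‖ := by
    intro h
    rw [← sq_eq_sq₀ (norm_nonneg _) (norm_nonneg _), norm_sq_eq, Lp_norm_sq_eq_integral]
    refine (integral_congr_ae (hPn h)).trans ?_
    exact (integral_map hqm.aemeasurable (hsq h).1).symm
  have hsurj : Function.Surjective T₀ := by
    intro f
    set g : EuclideanSpace ℝ (Fin d) → ℂ := fun x => f.1 x * (thetaWeight ν v x)⁻¹ with hg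
    have hgm : Measurable g :=
      f.1.stronglyMeasurable.measurable.mul (continuous_thetaWeight ν v).measurable.inv
    have hper : ∀ᵐ x, ∀ γ : Γ, g (x + (γ : EuclideanSpace ℝ (Fin d))) = g x := by
      refine ae_all_iff.2 fun γ => ?_
      filter_upwards [f.2.1 γ] with x hx
      have h1 := autFactor_ne_zero ν Γ χ γ x
      have h2 := thetaWeight_ne_zero ν v x
      simp only [hg, hx, thetaWeight_add ν χ v hv]
      field_simp
    -- a periodic function factors through the quotient, by means of the section
    have hfac : ∀ᵐ x, g (quotientSection b w (quotientMap b w x)) = g x := by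
      filter_upwards [hper] with x hx
      obtain ⟨γ, hγ⟩ := exists_quotientSection_quotientMap b w hb x
      rw [hγ, hx]
    have hm : Measurable (g ∘ quotientSection b w) := hgm.comp (measurable_quotientSection b w)
    have hL : MemLp (g ∘ quotientSection b w) 2 ρ := by
      rw [memLp_two_iff_integrable_sq_norm hm.aestronglyMeasurable, hρ, integrable_map_measure
        (hm.norm.pow_const 2).aestronglyMeasurable hqm.aemeasurable]
      refine f.2.2.congr ?_
      filter_upwards [ae_restrict_of_ae hfac] with x hx
      simp only [Function.comp_apply, hx]
      rw [← norm_mul_thetaWeight_sq_mul_exp ν v x (g x)]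
      simp only [hg]
      rw [inv_mul_cancel_right₀ (thetaWeight_ne_zero ν v x)]
    refine ⟨hL.toLp _, Subtype.ext (AEEqFun.ext ?_)⟩
    filter_upwards [hP (hL.toLp _), hq.ae hL.coeFn_toLp, hfac] with x h1 h2 h3
    change P (hL.toLp _) x = _
    rw [h1, h2, Function.comp_apply, h3]
    simp only [hg]
    rw [inv_mul_cancel_right₀ (thetaWeight_ne_zero ν v x)]
  refine ⟨LinearIsometryEquiv.ofSurjective ⟨T₀, hnorm⟩ hsurj, fun h => ?_⟩
  exact hP h

end Transfer

/-! ### Orthogonal bases, the dual lattice and characters -/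

theorem IsOrthogonalBasis.map_comp {ι κ H H' : Type*} [NormedAddCommGroup H]
    [InnerProductSpace ℂ H] [NormedAddCommGroup H'] [InnerProductSpace ℂ H'] {e : ι → H}
    (he : IsOrthogonalBasis e) (T : H ≃ₗᵢ[ℂ] H') (σ : κ ≃ ι) :
    IsOrthogonalBasis fun i => T (e (σ i)) where
  ne_zero i := by simpa using he.ne_zero (σ i)
  orthogonal i j hij := by
    change inner ℂ (T _) (T _) = 0
    rw [T.inner_map_map]
    exact he.orthogonal (σ.injective.ne hij)
  dense_span := by
    have h1 : Set.range (fun i => T (e (σ i))) = (T : H →ₗ[ℂ] H') '' Set.range e := by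
      rw [← Set.range_comp]
      exact σ.surjective.range_comp (T ∘ e)
    rw [h1, Submodule.span_image]
    have hd : Dense ((Submodule.span ℂ (Set.range e) : Submodule ℂ H) : Set H) :=
      Submodule.dense_iff_topologicalClosure_eq_top.2 he.dense_span
    refine Submodule.dense_iff_topologicalClosure_eq_top.1 ?_
    exact T.surjective.denseRange.dense_image T.continuous hd

/-- The functions `fourierHermite ν n k` form an orthogonal basis of `L²((ℝ/ℤ)^r × ℝ^m)`, for any
normalization of the measure. -/
theorem exists_isOrthogonalBasis_fourierHermite {r m : ℕ} {ν : ℝ} (hν : ∀ _ : Fin m, 0 < ν)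
    {c : ENNReal} (hc0 : c ≠ 0) (hc : c ≠ ⊤)
    {ρ : Measure (UnitAddTorus (Fin r) × (Fin m → ℝ))}
    (hρ : ρ = c • (torusMeasure r).prod volume) :
    ∃ e : (Fin r → ℤ) × (Fin m → ℕ) → Lp ℂ 2 ρ,
      (∀ q, e q =ᵐ[ρ] fourierHermite ν q.1 q.2) ∧ IsOrthogonalBasis e ∧
      ∀ q, ‖e q‖ ^ 2 = c.toReal * ((Real.pi / ν) ^ ((m : ℝ) / 2) * 2 ^ (∑ i, q.2 i) *
        ∏ i, ((q.2 i).factorial : ℝ)) := by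
  subst hρ
  have hmem : ∀ q : (Fin r → ℤ) × (Fin m → ℕ), MemLp (fourierHermite ν q.1 q.2) 2
      (c • (torusMeasure r).prod volume) := fun q =>
    (memLp_fourierHermite hν q.1 q.2).smul_measure hc
  have hcr : c.toReal ≠ 0 := ENNReal.toReal_ne_zero.2 ⟨hc0, hc⟩
  have hin : ∀ q (h : Lp ℂ 2 (c • (torusMeasure r).prod (volume : Measure (Fin m → ℝ)))),
      inner ℂ ((hmem q).toLp _) h =
        c.toReal * ∫ p, conj (fourierHermite ν q.1 q.2 p) * h p ∂(torusMeasure r).prod volume := by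
    intro q h
    rw [L2.inner_def, ← real_smul, ← integral_smul_measure]
    refine integral_congr_ae ?_
    filter_upwards [(hmem q).coeFn_toLp] with p hp
    rw [hp, RCLike.inner_apply, mul_comm]
  have hin' : ∀ q q', inner ℂ ((hmem q).toLp _) ((hmem q').toLp _) =
      c.toReal * ∫ p, conj (fourierHermite ν q.1 q.2 p) * fourierHermite ν q'.1 q'.2 p
        ∂(torusMeasure r).prod volume := by
    intro q q'
    rw [hin]
    congr 1
    refine integral_congr_ae ?_
    filter_upwards [(Measure.ae_ennreal_smul_measure_iff hc0).1 (hmem q').coeFn_toLp] with p hp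
    rw [hp]
  have hnorm : ∀ q, ‖(hmem q).toLp _‖ ^ 2 = c.toReal * ((Real.pi / ν) ^ ((m : ℝ) / 2) *
      2 ^ (∑ i, q.2 i) * ∏ i, ((q.2 i).factorial : ℝ)) := by
    intro q
    rw [← inner_self_eq_norm_sq (𝕜 := ℂ), hin', integral_conj_fourierHermite_mul_self hν,
      ← ofReal_mul]
    exact ofReal_re _
  refine ⟨fun q => (hmem q).toLp _, fun q => (hmem q).coeFn_toLp, ⟨fun q h0 => ?_, ?_, ?_⟩, hnorm⟩
  · have h1 := hnorm q
    rw [h0, norm_zero] at h1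
    have h2 : 0 < (Real.pi / ν) ^ ((m : ℝ) / 2) := by
      cases m with
      | zero => simp
      | succ m => exact Real.rpow_pos_of_pos (div_pos Real.pi_pos (hν 0)) _
    have h3 : 0 < ∏ i, ((q.2 i).factorial : ℝ) :=
      Finset.prod_pos fun i _ => by exact_mod_cast Nat.factorial_pos _
    have h4 : (0 : ℝ) < 2 ^ (∑ i, q.2 i) := by positivity
    have h5 := mul_ne_zero hcr (mul_pos (mul_pos h2 h4) h3).ne'
    exact h5 (by rw [← h1]; simp)
  · intro q q' hqq
    rw [hin', integral_conj_fourierHermite_mul_of_ne hν hqq, mul_zero]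
  · rw [Submodule.topologicalClosure_eq_top_iff, Submodule.eq_bot_iff]
    intro h hh
    have h1 : ∀ q, inner ℂ ((hmem q).toLp _) h = 0 := fun q =>
      (Submodule.mem_orthogonal _ h).1 hh _ (Submodule.subset_span ⟨q, rfl⟩)
    have h2 : MemLp h 2 ((torusMeasure r).prod volume) := by
      have := (Lp.memLp h).smul_measure (c := c⁻¹) (ENNReal.inv_ne_top.2 hc0)
      rwa [smul_smul, ENNReal.inv_mul_cancel hc0 hc, one_smul] at this
    have h3 := ae_eq_zero_of_forall_integral_conj_fourierHermite hν h2 fun n k => by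
      have h4 := h1 (n, k)
      rw [hin] at h4
      exact (mul_eq_zero.1 h4).resolve_left (by exact_mod_cast hcr)
    exact (Lp.eq_zero_iff_ae_eq_zero).2 ((Measure.ae_ennreal_smul_measure_iff hc0).2 h3)

section Dual

variable {d r m : ℕ} {Γ : AddSubgroup (EuclideanSpace ℝ (Fin d))}
  (b : Module.Basis (Fin r) ℝ (realSpan Γ))

theorem inner_eq_sum_repr_mul (y : EuclideanSpace ℝ (Fin d)) (x : realSpan Γ) :
    inner ℝ y (x : EuclideanSpace ℝ (Fin d)) =
      ∑ i, b.repr x i * inner ℝ y (b i : EuclideanSpace ℝ (Fin d)) := by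
  conv_lhs => rw [← b.sum_repr x]
  simp only [Submodule.coe_sum, Submodule.coe_smul, inner_sum, real_inner_smul_right]

theorem exists_mem_realSpan_inner_eq (θ : Fin r → ℝ) :
    ∃ y ∈ realSpan Γ, ∀ i, inner ℝ y (b i : EuclideanSpace ℝ (Fin d)) = θ i := by
  let y := (InnerProductSpace.toDual ℝ (realSpan Γ)).symm
    (LinearMap.toContinuousLinearMap (b.constr ℝ θ))
  refine ⟨y, y.2, fun i => ?_⟩
  rw [← Submodule.coe_inner, InnerProductSpace.toDual_symm_apply]
  simp

theorem eq_of_forall_inner_basis_eq {y z : EuclideanSpace ℝ (Fin d)} (hy : y ∈ realSpan Γ)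
    (hz : z ∈ realSpan Γ) (h : ∀ i, inner ℝ y (b i : EuclideanSpace ℝ (Fin d)) =
      inner ℝ z (b i : EuclideanSpace ℝ (Fin d))) : y = z := by
  have h1 : inner ℝ (y - z) (y - z) = 0 := by
    rw [inner_eq_sum_repr_mul b (y - z) ⟨y - z, Submodule.sub_mem _ hy hz⟩]
    refine Finset.sum_eq_zero fun i _ => ?_
    rw [inner_sub_left, h i, sub_self, mul_zero]
  exact sub_eq_zero.1 (inner_self_eq_zero.1 h1)

variable (hb : ∀ x : realSpan Γ, (x : EuclideanSpace ℝ (Fin d)) ∈ Γ ↔ ∀ i, ∃ n : ℤ, b.repr x i = n)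

include hb in
theorem basis_mem (i : Fin r) : (b i : EuclideanSpace ℝ (Fin d)) ∈ Γ := by
  classical
  rw [hb]
  intro j
  rw [b.repr_self, Finsupp.single_apply]
  split_ifs
  · exact ⟨1, by simp⟩
  · exact ⟨0, by simp⟩

include hb in
/-- The pairings with a basis of `Γ` identify the dual lattice with `ℤ^r`. -/
theorem exists_equiv_dualLattice : ∃ N : dualLattice Γ ≃ (Fin r → ℤ),
    ∀ (y : dualLattice Γ) (i : Fin r),
    inner ℝ (y : EuclideanSpace ℝ (Fin d)) (b i : EuclideanSpace ℝ (Fin d)) = (N y i : ℝ) := by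
  choose N hN using fun (y : dualLattice Γ) (i : Fin r) => y.2.2 (b i) (basis_mem b hb i)
  refine ⟨Equiv.ofBijective N ⟨fun y z h => ?_, fun n => ?_⟩, hN⟩
  · refine Subtype.ext (eq_of_forall_inner_basis_eq b y.2.1 z.2.1 fun i => ?_)
    rw [hN, hN, h]
  · obtain ⟨y, hy, hyn⟩ := exists_mem_realSpan_inner_eq b fun i => (n i : ℝ)
    have hmem : y ∈ dualLattice Γ := by
      refine ⟨hy, fun γ hγ => ?_⟩
      choose c hc using (hb ⟨γ, Submodule.subset_span hγ⟩).1 hγ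
      refine ⟨∑ i, c i * n i, ?_⟩
      rw [inner_eq_sum_repr_mul b y ⟨γ, Submodule.subset_span hγ⟩]
      push_cast
      exact Finset.sum_congr rfl fun i _ => by rw [hc, hyn]
    refine ⟨⟨y, hmem⟩, funext fun i => ?_⟩
    have h1 := hN ⟨y, hmem⟩ i
    rw [hyn] at h1
    exact_mod_cast h1.symm

include hb in
/-- Every character of `Γ` is the restriction of a character of its real span. -/
theorem exists_character_eq (χ : AddChar Γ Circle) : ∃ v ∈ realSpan Γ, ∀ γ : Γ,
    (χ γ : ℂ) = exp (2 * (Real.pi : ℂ) * I *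
      ((inner ℝ v (γ : EuclideanSpace ℝ (Fin d)) : ℝ) : ℂ)) := by
  set β : Fin r → Γ := fun i => ⟨b i, basis_mem b hb i⟩
  obtain ⟨v, hv, hvb⟩ := exists_mem_realSpan_inner_eq b
    fun i => ((χ (β i) : ℂ).arg) / (2 * Real.pi)
  refine ⟨v, hv, fun γ => ?_⟩
  set x : realSpan Γ := ⟨γ, Submodule.subset_span γ.2⟩
  choose n hn using (hb x).1 γ.2
  have hγ : γ = ∑ i, n i • β i := by
    refine Subtype.ext ?_
    have h1 := congrArg (Subtype.val) (b.sum_repr x)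
    rw [AddSubgroup.val_finsetSum]
    refine h1.symm.trans ?_
    rw [Submodule.coe_sum]
    refine Finset.sum_congr rfl fun i _ => ?_
    rw [hn, Submodule.coe_smul, Int.cast_smul_eq_zsmul]
    rfl
  have h1 : ∀ i, (χ (β i) : ℂ) = exp (((χ (β i) : ℂ).arg : ℝ) * I) := by
    intro i
    have := norm_mul_exp_arg_mul_I (χ (β i) : ℂ)
    rwa [Circle.norm_coe, ofReal_one, one_mul, eq_comm] at this
  have h2 : inner ℝ v (γ : EuclideanSpace ℝ (Fin d)) =
      ∑ i, (n i : ℝ) * (((χ (β i) : ℂ).arg) / (2 * Real.pi)) := by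
    rw [show (γ : EuclideanSpace ℝ (Fin d)) = (x : EuclideanSpace ℝ (Fin d)) from rfl,
      inner_eq_sum_repr_mul b]
    exact Finset.sum_congr rfl fun i _ => by rw [hn, hvb]
  rw [h2]
  conv_lhs => rw [hγ]
  have h4 : χ (∑ i, n i • β i) = ∏ i, χ (n i • β i) :=
    map_prod χ.toMonoidHom (fun i => Multiplicative.ofAdd (n i • β i)) Finset.univ
  have h5 : ((∏ i, χ (n i • β i) : Circle) : ℂ) = ∏ i, (χ (n i • β i) : ℂ) :=
    map_prod Circle.coeHom _ _
  rw [h4, h5]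
  simp only [AddChar.map_zsmul_eq_zpow, Circle.coe_zpow]
  rw [ofReal_sum, Finset.mul_sum, exp_sum]
  refine Finset.prod_congr rfl fun i _ => ?_
  conv_lhs => rw [h1 i]
  rw [← exp_int_mul]
  congr 1
  have h3 : (Real.pi : ℂ) ≠ 0 := by exact_mod_cast Real.pi_ne_zero
  push_cast
  field_simp

theorem mFourier_quotientMap (w : OrthonormalBasis (Fin m) ℝ (realSpan Γ)ᗮ) (n : Fin r → ℤ)
    {y : EuclideanSpace ℝ (Fin d)}
    (hyn : ∀ i, inner ℝ y (b i : EuclideanSpace ℝ (Fin d)) = (n i : ℝ))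
    (x : EuclideanSpace ℝ (Fin d)) :
    UnitAddTorus.mFourier n (quotientMap b w x).1 =
      exp (2 * (Real.pi : ℂ) * I *
        ((inner ℝ y ((realSpan Γ).starProjection x) : ℝ) : ℂ)) := by
  rw [Submodule.starProjection_apply, inner_eq_sum_repr_mul b, ofReal_sum, Finset.mul_sum, exp_sum]
  change ∏ i, fourier (n i) ((quotientMap b w x).1 i) = _
  refine Finset.prod_congr rfl fun i _ => ?_
  change fourier (n i) ((b.repr ((realSpan Γ).orthogonalProjectionOnto x) i : ℝ) : UnitAddCircle) = _
  rw [fourier_coe_apply, hyn]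
  congr 1
  push_cast
  ring

theorem inner_starProjection_eq {V : Submodule ℝ (EuclideanSpace ℝ (Fin d))}
    {v : EuclideanSpace ℝ (Fin d)} (hv : v ∈ V) (x : EuclideanSpace ℝ (Fin d)) :
    inner ℝ v (V.starProjection x) = inner ℝ v x := by
  rw [← V.inner_starProjection_left_eq_right, Submodule.starProjection_eq_self_iff.2 hv]

/-- The function `basisFun` is `thetaWeight` times the pullback of a function `fourierHermite`. -/
theorem basisFun_eq (w : OrthonormalBasis (Fin m) ℝ (realSpan Γ)ᗮ) {ν : ℝ}
    {v y : EuclideanSpace ℝ (Fin d)} (hv : v ∈ realSpan Γ) {n : Fin r → ℤ}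
    (hyn : ∀ i, inner ℝ y (b i : EuclideanSpace ℝ (Fin d)) = (n i : ℝ)) (k : Fin m → ℕ)
    (x : EuclideanSpace ℝ (Fin d)) :
    basisFun ν Γ w v y k x = fourierHermite ν n k (quotientMap b w x) * thetaWeight ν v x := by
  have h1 : ‖x‖ ^ 2 = ‖(realSpan Γ).starProjection x‖ ^ 2 +
      ∑ j, (quotientMap b w x).2 j ^ 2 := by
    rw [(realSpan Γ).norm_sq_eq_add_norm_sq_projection x]
    congr 1
    rw [← w.repr.norm_map, EuclideanSpace.norm_sq_eq]
    simp [quotientMap]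
  have h2 : ∏ j, (hermiteFun ν (k j) ((quotientMap b w x).2 j) : ℂ) =
      (hermite k (fun j => Real.sqrt ν * (quotientMap b w x).2 j) : ℂ) *
        exp ((-(ν / 2) * ∑ j, (quotientMap b w x).2 j ^ 2 : ℝ) : ℂ) := by
    rw [hermite_eq_prod, Finset.mul_sum, ← ofReal_exp, Real.exp_sum, ← ofReal_mul,
      ← Finset.prod_mul_distrib, ofReal_prod]
    rfl
  have h3 : basisFun ν Γ w v y k x =
      exp (((ν / 2 * inner ℝ ((realSpan Γ).starProjection x) ((realSpan Γ).starProjection x) : ℝ) :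
        ℂ) + 2 * (Real.pi : ℂ) * I *
          ((inner ℝ (v + y) ((realSpan Γ).starProjection x) : ℝ) : ℂ)) *
        (hermite k (fun j => Real.sqrt ν * (quotientMap b w x).2 j) : ℂ) := rfl
  rw [h3, fourierHermite, h2, mFourier_quotientMap b w n hyn, thetaWeight, h1, inner_add_left,
    inner_starProjection_eq hv, real_inner_self_eq_norm_sq]
  have h4 : ∀ A B C D H : ℂ, D = B + C + A → exp D * H = exp B * (H * exp C) * exp A := by
    rintro A B C D H rfl
    rw [exp_add, exp_add]
    ring
  apply h4
  push_cast
  ring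

end Dual

end LikewiseTheta

theorem theorem2p1 {d r : ℕ} (Γ : AddSubgroup (EuclideanSpace ℝ (Fin d))) [DiscreteTopology Γ]
    (hr : Module.finrank ℤ Γ = r)
    -- `ν` is positive; `ν = 0` is allowed when `Γ` has full rank
    (ν : ℝ) (hν : 0 ≤ ν) (hν' : r < d → 0 < ν)
    (χ : AddChar Γ Circle)
    -- a fundamental domain of `Γ` in `ℝ^d`, and one in the span of `Γ`
    {Λ : Set (EuclideanSpace ℝ (Fin d))} (hΛ : IsAddFundamentalDomain Γ Λ volume)
    {Λ₁ : Set (LikewiseTheta.realSpan Γ)}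
    (hΛ₁ : IsAddFundamentalDomain (LikewiseTheta.latticeInSpan Γ) Λ₁ volume)
    (w : OrthonormalBasis (Fin (d - r)) ℝ (LikewiseTheta.realSpan Γ)ᗮ) :
    (∃ v ∈ LikewiseTheta.realSpan Γ, ∀ γ : Γ,
      (χ γ : ℂ) = Complex.exp (2 * (Real.pi : ℂ) * Complex.I *
        ((inner ℝ v (γ : EuclideanSpace ℝ (Fin d)) : ℝ) : ℂ))) ∧
    ∀ v ∈ LikewiseTheta.realSpan Γ,
      (∀ γ : Γ, (χ γ : ℂ) = Complex.exp (2 * (Real.pi : ℂ) * Complex.I *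
        ((inner ℝ v (γ : EuclideanSpace ℝ (Fin d)) : ℝ) : ℂ))) →
      CompleteSpace (LikewiseTheta.thetaSpace ν Γ χ hΛ) ∧
      ∃ e : LikewiseTheta.dualLattice Γ × (Fin (d - r) → ℕ) → LikewiseTheta.thetaSpace ν Γ χ hΛ,
        (∀ i, ((e i).1 : EuclideanSpace ℝ (Fin d) → ℂ) =ᵐ[volume]
          LikewiseTheta.basisFun ν Γ w v i.1 i.2) ∧
        LikewiseTheta.IsOrthogonalBasis e ∧
        ∀ i, ‖e i‖ ^ 2 = volume.real Λ₁ * (Real.pi / ν) ^ (((d : ℝ) - r) / 2) *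
          2 ^ (∑ j, i.2 j) * ∏ j, ((i.2 j).factorial : ℝ) := by
  obtain ⟨b, hb⟩ := LikewiseTheta.exists_basis_mem_iff Γ hr
  refine ⟨LikewiseTheta.exists_character_eq b hb χ, fun v hv hχ => ?_⟩
  have hcount : Countable Γ := LikewiseTheta.countable_of_discrete Γ
  have hrd : r ≤ d := by
    have h1 := Submodule.finrank_le (LikewiseTheta.realSpan Γ)
    rwa [Module.finrank_eq_card_basis b, Fintype.card_fin, finrank_euclideanSpace,
      Fintype.card_fin] at h1
  have hpos : ∀ _ : Fin (d - r), 0 < ν := fun i => hν' (by have := i.2; omega)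
  have hc : volume Λ₁ ≠ ⊤ := LikewiseTheta.volume_fundamentalDomain_ne_top b hb hΛ₁
  have hc0 : volume Λ₁ ≠ 0 := hΛ₁.measure_ne_zero (NeZero.ne volume)
  obtain ⟨T, hT⟩ := LikewiseTheta.exists_linearIsometryEquiv_thetaSpace b w hb ν χ hχ hΛ
  obtain ⟨E, hE, hEb, hEn⟩ := LikewiseTheta.exists_isOrthogonalBasis_fourierHermite hpos hc0 hc
    (LikewiseTheta.map_quotientMap_restrict b w hb hΛ₁ hΛ)
  obtain ⟨N, hN⟩ := LikewiseTheta.exists_equiv_dualLattice b hb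
  refine ⟨T.toIsometryEquiv.completeSpace_iff.1 inferInstance,
    fun i => T (E ((N.prodCongr (Equiv.refl _)) i)), fun i => ?_, hEb.map_comp T _, fun i => ?_⟩
  · filter_upwards [hT (E ((N.prodCongr (Equiv.refl _)) i)),
      (LikewiseTheta.quasiMeasurePreserving_quotientMap b w hb hΛ).ae
        (hE ((N.prodCongr (Equiv.refl _)) i))] with x h1 h2
    rw [h1, h2, LikewiseTheta.basisFun_eq b w hv (hN i.1)]
    rfl
  · rw [T.norm_map, hEn, Nat.cast_sub hrd, mul_assoc, mul_assoc, mul_assoc]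
    rfl
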